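/- For $p\in(0,1)$ and $x\in[0,1]$ let $I_p(x)=x\log\frac{x}{p}+(1-x)\log\frac{1-x}{1-p}$ (with $0\log 0:=0$). Let $\mathcal X_N$ be the set of symmetric $N\times N$ matrices with entries in $[0,1]$ and zero diagonal, and for $X=(x_{ij})\in\mathcal X_N$ let $I_p(X)=\sum_{1\le i<j\le N}I_p(x_{ij})$. For $h:\mathcal X_N\to\mathbb R$ and $t\in\mathbb R$ put $$\psi(h,N,p,t)=\inf\{I_p(X): X\in\mathcal X_N,\ h(X)\le t\}.$$ For a real symmetric matrix $X$ with eigenvalues $\lambda_1,\dots,\lambda_N$ (counted with multiplicity) and $\alpha\in[1,\infty]$, let $\|X\|_{S_\alpha}=\big(\sum_j|\lambda_j|^\alpha\big)^{1/\alpha}$ be the Schatten norm, where $\|X\|_{S_\infty}=\max_j|\lambda_j|$. Let $A=A_{N,p}$ be the adjacency matrix of the Erdős–Rényi random graph $G(N,p)$ (each of the $\binom N2$ possible edges present independently with probability $p$). **Theorem.** (i) For all $0<q<p<1$, all $\alpha\in[1,\infty]$ and all integers $N\ge1$, $$\mathbb P\big(\|A_{N,p}\|_{S_\alpha}\le q(N-1)\big)\le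 e^{-\psi(\|\cdot\|_{S_\alpha},N,p,q(N-1))}\le e^{-\binom N2 I_p(q)}.$$ (ii) Let $\alpha\in(2,\infty]$ and $s\in(0,1)$ be fixed, and let $p=p(N)\in[0,1]$ satisfy $p(N)\le 1/2$ for all large $N$ and, as $N\to\infty$, $N^{2/\alpha-1}/p(N)\to0$ if $\alpha<\infty$, respectively $\frac{(\log N)^6}{N\,p(N)}\to0$ if $\alpha=\infty$. Then with $q=q(N)=s\,p(N)$ there is a sequence $\varepsilon_N\to0$ such that, for all sufficiently large $N$, $$\mathbb P\big(\|A_{N,p}\|_{S_\alpha}\le q(N-1)\big)\ge e^{-(1+\varepsilon_N)\binom N2 I_p(q)}.$$ -/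

import Mathlib

open Filter Asymptotics MeasureTheory
open scoped Topology ENNReal

noncomputable section

namespace SchattenTail

/-- The symmetric `N × N` real matrices with entries in `[0,1]` and zeros on the diagonal. -/
def cX (N : ℕ) : Set (Matrix (Fin N) (Fin N) ℝ) :=
  {X | X.IsSymm ∧ (∀ i, X i i = 0) ∧ ∀ i j, X i j ∈ Set.Icc (0 : ℝ) 1}

theorem cX_isHermitian {N : ℕ} (X : cX N) : (X : Matrix (Fin N) (Fin N) ℝ).IsHermitian := by
  rw [Matrix.IsHermitian, Matrix.conjTranspose_eq_transpose_of_trivial]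
  exact X.2.1

/-- The Schatten norm of order `α ∈ [1,∞]`: the `ℓ^α` norm of the eigenvalues, listed with
multiplicity, i.e. `(∑ |λ_j| ^ α) ^ (1/α)` for finite `α` and `max |λ_j|` for `α = ∞`. -/
def schattenNorm {N : ℕ} (α : ℝ≥0∞) (X : cX N) : ℝ :=
  ‖WithLp.toLp α (cX_isHermitian X).eigenvalues‖

open Classical in
/-- The adjacency matrix of a graph on `N` labelled vertices, as an element of `cX N`. -/
def adj {N : ℕ} (G : SimpleGraph (Fin N)) : cX N :=
  ⟨G.adjMatrix ℝ, G.isSymm_adjMatrix, fun i => by simp, fun i j => by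
    rw [SimpleGraph.adjMatrix_apply]
    split_ifs <;> simp⟩

/-- The Kullback-Leibler divergence of Bernoulli(`x`) from Bernoulli(`p`); the convention
`0 log 0 = 0` holds since the logarithms are multiplied by `x` and `1 - x`. -/
def bernoulliKL (p x : ℝ) : ℝ :=
  x * Real.log (x / p) + (1 - x) * Real.log ((1 - x) / (1 - p))

/-- `I_p(X)`, the sum of `I_p(x_ij)` over `i < j`. -/
def entropy {N : ℕ} (p : ℝ) (X : cX N) : ℝ :=
  ∑ i : Fin N, ∑ j ∈ Finset.Ioi i, bernoulliKL p ((X : Matrix (Fin N) (Fin N) ℝ) i j)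

/-- The lower-tail variational problem: the infimum of `I_p(X)` over the `X` in `cX N` with
`h X ≤ t`. (The infimum is over a set of nonnegative reals for `0 < p < 1`; it is used only where
the zero matrix is a competitor, so the set is nonempty.) -/
def psi {N : ℕ} (h : cX N → ℝ) (p t : ℝ) : ℝ :=
  sInf (entropy p '' {X | h X ≤ t})

/-- The probability that the adjacency matrix `A` of the random graph `G(N,p)` satisfies
`‖A‖_{S_α} ≤ t`. -/
def lowerTail (α : ℝ≥0∞) (N : ℕ) (p : unitInterval) (t : ℝ) : ℝ :=
  (SimpleGraph.binomialRandom (Fin N) p).real {G | schattenNorm α (adj G) ≤ t}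

end SchattenTail

end

/-! Upper bounds. Let `K` be the event, a set of graphs. Then `-log P(K)` is the relative entropy of
the law conditioned on `K`. By Gibbs' inequality this is at least the entropy of the product measure
with the same edge marginals, that is, `I_p` of the conditional mean matrix
(`log_sum_graphWeight_le`). Schatten norms are convex (`norm_eigenvalues_sum_le`), so this mean
still satisfies the norm constraint and competes in `psi`. The second bound tests a competitor
against the all-ones vector: its entries average at most `q`, and `I_p` lies above its tangent line
at `q`.

Lower bound. Tilt `G(N,p)` to `G(N,q)` with `q = (1 - δ) s p`. There `A = q (J - I) + centered`,
whose norm is about `N q` once the centered part has norm at most `δ N q`. This holds with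
probability close to one by a trace moment bound (`expect_trace_pow_le`) and Markov's inequality,
with a fixed power for finite `α` and a power of order `log N` for `α = ∞`. The change of measure
(`mul_log_sum_graphWeight_le`) costs the relative entropy `binom(N,2) I_p(q)`, which is within a
factor `1 + O(δ)` of the target since `I_p(s p)` is at least a constant times `p`. -/

noncomputable section

namespace SchattenTail

/-! ### Product measures on graphs -/

/-- The unordered pairs of distinct vertices, i.e. the possible edges. -/
def pairs (N : ℕ) : Finset (Sym2 (Fin N)) := Finset.univ.filter fun e => ¬ e.IsDiag

theorem mem_pairs {N : ℕ} {e : Sym2 (Fin N)} : e ∈ pairs N ↔ ¬ e.IsDiag := by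
  simp [pairs]

theorem card_pairs (N : ℕ) : (pairs N).card = N.choose 2 := by
  have := Sym2.card_subtype_not_diag (α := Fin N)
  rw [Fintype.card_subtype, Fintype.card_fin] at this
  exact this

theorem sum_pairs {N : ℕ} (F : Sym2 (Fin N) → ℝ) :
    ∑ e ∈ pairs N, F e = ∑ i : Fin N, ∑ j ∈ Finset.Ioi i, F s(i, j) := by
  have h := Finset.sum_sym2_filter_not_isDiag (Finset.univ : Finset (Fin N)) F
  rw [Finset.sym2_univ] at h
  rw [pairs, h, Finset.sum_sigma']
  refine Finset.sum_bij' (fun x _ => ⟨x.1, x.2⟩) (fun x _ => (x.1, x.2)) ?_ ?_ ?_ ?_ ?_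
  · intro x hx
    simp at hx
    simp [hx]
  · rintro ⟨i, j⟩ hx
    simp at hx
    simp [hx, hx.ne]
  all_goals simp

open Classical in
/-- The probability of the graph `G` when each pair `e` is an edge with probability `y e`,
independently. -/
def graphWeight {N : ℕ} (y : Sym2 (Fin N) → ℝ) (G : SimpleGraph (Fin N)) : ℝ :=
  ∏ e ∈ pairs N, if e ∈ G.edgeSet then y e else 1 - y e

-- Expanding the product of sums gives one term for each set of non-loop pairs, and these sets are
-- exactly the edge sets of graphs.
open Classical in
theorem sum_prod_edges {N : ℕ} (a b : Sym2 (Fin N) → ℝ) :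
    ∑ G : SimpleGraph (Fin N), ∏ e ∈ pairs N, (if e ∈ G.edgeSet then a e else b e) =
      ∏ e ∈ pairs N, (a e + b e) := by
  rw [Finset.prod_add]
  have hsub : ∀ G : SimpleGraph (Fin N), (pairs N).filter (fun e => e ∈ G.edgeSet) =
      G.edgeFinset := by
    intro G
    ext e
    simp only [Finset.mem_filter, mem_pairs, SimpleGraph.mem_edgeFinset, and_iff_right_iff_imp]
    exact fun h => G.not_isDiag_of_mem_edgeSet h
  refine Finset.sum_bij (fun G _ => G.edgeFinset) ?_ ?_ ?_ ?_
  · intro G _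
    rw [Finset.mem_powerset, ← hsub]
    exact Finset.filter_subset _ _
  · intro G _ H _ h
    exact SimpleGraph.edgeFinset_inj.1 h
  · intro S hS
    refine ⟨SimpleGraph.fromEdgeSet (S : Set (Sym2 (Fin N))), Finset.mem_univ _, ?_⟩
    refine (hsub _).symm.trans ?_
    ext e
    have : e ∈ S → ¬ e.IsDiag := fun h => mem_pairs.1 (Finset.mem_powerset.1 hS h)
    simp only [Finset.mem_filter, mem_pairs, SimpleGraph.edgeSet_fromEdgeSet]
    simp
    tauto
  · intro G _
    rw [Finset.prod_ite, hsub]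
    congr 1
    apply Finset.prod_congr _ fun _ _ => rfl
    rw [← hsub]
    ext e
    simp +contextual [mem_pairs]

open Classical in
theorem sum_graphWeight_mul_prod {N : ℕ} (y a b : Sym2 (Fin N) → ℝ) :
    ∑ G : SimpleGraph (Fin N), graphWeight y G *
        ∏ e ∈ pairs N, (if e ∈ G.edgeSet then a e else b e) =
      ∏ e ∈ pairs N, (y e * a e + (1 - y e) * b e) := by
  rw [← sum_prod_edges]
  refine Finset.sum_congr rfl fun G _ => ?_
  rw [graphWeight, ← Finset.prod_mul_distrib]
  refine Finset.prod_congr rfl fun e _ => ?_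
  split_ifs <;> rfl

theorem sum_graphWeight {N : ℕ} (y : Sym2 (Fin N) → ℝ) :
    ∑ G : SimpleGraph (Fin N), graphWeight y G = 1 := by
  have := sum_graphWeight_mul_prod y (fun _ => 1) (fun _ => 1)
  simpa using this

open Classical in
/-- The marginal of an edge. -/
theorem sum_graphWeight_edge {N : ℕ} (y : Sym2 (Fin N) → ℝ) {e : Sym2 (Fin N)} (he : e ∈ pairs N)
    (a b : ℝ) :
    ∑ G : SimpleGraph (Fin N), graphWeight y G * (if e ∈ G.edgeSet then a else b) =
      y e * a + (1 - y e) * b := by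
  have h := sum_graphWeight_mul_prod y (fun f => if f = e then a else 1)
    (fun f => if f = e then b else 1)
  rw [Finset.prod_eq_single e (by intro f _ hf; simp [hf]) (by intro h; exact absurd he h)] at h
  simp only [if_true] at h
  rw [← h]
  refine Finset.sum_congr rfl fun G _ => ?_
  congr 1
  rw [Finset.prod_eq_single e (by intro f _ hf; simp [hf]) (by intro h; exact absurd he h)]
  simp

theorem graphWeight_nonneg {N : ℕ} {y : Sym2 (Fin N) → ℝ} (h0 : ∀ e, 0 ≤ y e) (h1 : ∀ e, y e ≤ 1)
    (G : SimpleGraph (Fin N)) : 0 ≤ graphWeight y G := by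
  refine Finset.prod_nonneg fun e _ => ?_
  split_ifs
  · exact h0 e
  · linarith [h1 e]

theorem graphWeight_pos {N : ℕ} {y : Sym2 (Fin N) → ℝ} (G : SimpleGraph (Fin N))
    (h0 : ∀ e ∈ pairs N, e ∈ G.edgeSet → 0 < y e)
    (h1 : ∀ e ∈ pairs N, e ∉ G.edgeSet → y e < 1) : 0 < graphWeight y G := by
  refine Finset.prod_pos fun e he => ?_
  split_ifs with h
  · exact h0 e he h
  · linarith [h1 e he h]

open Classical in
theorem log_graphWeight {N : ℕ} {y : Sym2 (Fin N) → ℝ} (G : SimpleGraph (Fin N))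
    (h : graphWeight y G ≠ 0) :
    Real.log (graphWeight y G) =
      ∑ e ∈ pairs N, if e ∈ G.edgeSet then Real.log (y e) else Real.log (1 - y e) := by
  rw [graphWeight, Real.log_prod]
  · refine Finset.sum_congr rfl fun e _ => ?_
    split_ifs <;> rfl
  · exact Finset.prod_ne_zero_iff.1 h

/-! ### The law of `G(N,p)` as a finite sum of weights -/

theorem binomialRandom_real_singleton {N : ℕ} (p : unitInterval) (G : SimpleGraph (Fin N)) :
    (SimpleGraph.binomialRandom (Fin N) p).real {G} = graphWeight (fun _ => (p : ℝ)) G := by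
  classical
  rw [graphWeight, Finset.prod_ite, Finset.prod_const, Finset.prod_const, measureReal_def,
    SimpleGraph.binomialRandom_singleton]
  have h1 : (pairs N).filter (fun e => e ∈ G.edgeSet) = G.edgeFinset := by
    ext e
    simp only [Finset.mem_filter, mem_pairs, SimpleGraph.mem_edgeFinset, and_iff_right_iff_imp]
    exact fun h => G.not_isDiag_of_mem_edgeSet h
  have h2 : ((pairs N).filter (fun e => e ∉ G.edgeSet)).card =
      N.choose 2 - G.edgeFinset.card := by
    rw [← card_pairs, ← h1]
    have := Finset.card_filter_add_card_filter_not (s := pairs N) (fun e => e ∈ G.edgeSet)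
    omega
  have h3 : G.edgeSet.ncard = G.edgeFinset.card := by
    rw [Set.ncard_eq_toFinset_card']
    rfl
  rw [h1, h2, h3]
  simp

instance {N : ℕ} : MeasurableSingletonClass (SimpleGraph (Fin N)) where
  measurableSet_singleton G := by
    have h : ({G} : Set (SimpleGraph (Fin N))) = SimpleGraph.edgeSet ⁻¹' {G.edgeSet} := by
      ext H
      simp
    rw [h]
    exact SimpleGraph.measurable_edgeSet (measurableSet_singleton _)

open Classical in
theorem binomialRandom_real {N : ℕ} (p : unitInterval) (K : Set (SimpleGraph (Fin N))) :
    (SimpleGraph.binomialRandom (Fin N) p).real K =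
      ∑ G ∈ Finset.univ.filter (fun G => G ∈ K), graphWeight (fun _ => (p : ℝ)) G := by
  have h := sum_measureReal_singleton (μ := SimpleGraph.binomialRandom (Fin N) p)
    (Finset.univ.filter (fun G => G ∈ K))
  simp only [binomialRandom_real_singleton] at h
  rw [h]
  congr 1
  ext G
  simp

/-! ### Estimates for the Bernoulli divergence -/

theorem bernoulliKL_eq_sub {p : ℝ} (hp0 : p ≠ 0) (hp1 : 1 - p ≠ 0) (x : ℝ) :
    bernoulliKL p x = x * (Real.log x - Real.log p) +
      (1 - x) * (Real.log (1 - x) - Real.log (1 - p)) := by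
  rw [bernoulliKL]
  congr 1
  · rcases eq_or_ne x 0 with rfl | hx
    · simp
    · rw [Real.log_div hx hp0]
  · rcases eq_or_ne (1 - x) 0 with hx | hx
    · simp [hx]
    · rw [Real.log_div hx hp1]

/-- The affine corrections in `klFun` cancel between the two terms, so nonnegativity and convexity
are inherited from `klFun`. -/
theorem bernoulliKL_eq_klFun {p : ℝ} (hp0 : p ≠ 0) (hp1 : 1 - p ≠ 0) (x : ℝ) :
    bernoulliKL p x = p * InformationTheory.klFun (x / p) +
      (1 - p) * InformationTheory.klFun ((1 - x) / (1 - p)) := by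
  rw [bernoulliKL, InformationTheory.klFun_apply, InformationTheory.klFun_apply]
  field_simp
  ring

theorem bernoulliKL_nonneg {p x : ℝ} (hp0 : 0 < p) (hp1 : p < 1) (hx0 : 0 ≤ x) (hx1 : x ≤ 1) :
    0 ≤ bernoulliKL p x := by
  have h1 : 0 < 1 - p := by linarith
  rw [bernoulliKL_eq_klFun hp0.ne' h1.ne']
  have := InformationTheory.klFun_nonneg (x := x / p) (by positivity)
  have := InformationTheory.klFun_nonneg (x := (1 - x) / (1 - p))
    (div_nonneg (by linarith) h1.le)
  positivity

/-- The cost is at least a constant times `p`, which later turns additive errors of order `δ * p`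
into relative ones. -/
theorem bernoulliKL_lower {p s : ℝ} (hp0 : 0 < p) (hp1 : p < 1) (hs1 : s < 1) :
    p * InformationTheory.klFun s ≤ bernoulliKL p (s * p) := by
  have h1 : 0 < 1 - p := by linarith
  rw [bernoulliKL_eq_klFun hp0.ne' h1.ne', mul_div_cancel_right₀ _ hp0.ne']
  have := InformationTheory.klFun_nonneg (x := (1 - s * p) / (1 - p))
    (div_nonneg (by nlinarith) h1.le)
  have := mul_nonneg h1.le this
  linarith

/-- The right side minus the left side is exactly `bernoulliKL q x`. -/
theorem bernoulliKL_tangent {p q x : ℝ} (hp0 : 0 < p) (hp1 : p < 1) (hq0 : 0 < q) (hq1 : q < 1)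
    (hx0 : 0 ≤ x) (hx1 : x ≤ 1) :
    bernoulliKL p q + (Real.log q - Real.log p - (Real.log (1 - q) - Real.log (1 - p))) * (x - q) ≤
      bernoulliKL p x := by
  have h := bernoulliKL_nonneg hq0 hq1 hx0 hx1
  rw [bernoulliKL_eq_sub hq0.ne' (by linarith)] at h
  rw [bernoulliKL_eq_sub hp0.ne' (by linarith), bernoulliKL_eq_sub hp0.ne' (by linarith)]
  linarith

theorem bernoulliKL_zero_le {p : ℝ} (hp0 : 0 < p) (hp2 : p ≤ 1 / 2) :
    bernoulliKL p 0 ≤ 2 * p := by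
  have h1 : 0 < 1 - p := by linarith
  have : bernoulliKL p 0 = Real.log (1 / (1 - p)) := by simp [bernoulliKL]
  rw [this]
  refine (Real.log_le_sub_one_of_pos (by positivity)).trans ?_
  rw [div_sub_one h1.ne', div_le_iff₀ h1]
  nlinarith

/-- Moving the parameter from `s * p` to `(1 - δ) * (s * p)` costs at most `2 * δ * p`. -/
theorem bernoulliKL_smul_le {p s δ : ℝ} (hp0 : 0 < p) (hp2 : p ≤ 1 / 2) (hs0 : 0 < s) (hs1 : s < 1)
    (hδ0 : 0 ≤ δ) (hδ1 : δ ≤ 1) :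
    bernoulliKL p ((1 - δ) * s * p) ≤ bernoulliKL p (s * p) + δ * (2 * p) := by
  have h1 : 0 < 1 - p := by linarith
  have hc := InformationTheory.convexOn_klFun
  have hsp : s * p < 1 := by nlinarith
  have e : ∀ x, bernoulliKL p x = p * InformationTheory.klFun (x / p) +
      (1 - p) * InformationTheory.klFun ((1 - x) / (1 - p)) :=
    bernoulliKL_eq_klFun hp0.ne' h1.ne'
  -- Convexity on the segment from `s * p` to `0`; the far end costs at most `2 * p`.
  have c1 := hc.2 (Set.mem_Ici.2 (show 0 ≤ s * p / p by positivity))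
    (Set.mem_Ici.2 (show 0 ≤ 0 / p by simp)) (sub_nonneg.2 hδ1) hδ0 (sub_add_cancel 1 δ)
  have c2 := hc.2 (Set.mem_Ici.2 (show 0 ≤ (1 - s * p) / (1 - p) from
      div_nonneg (by linarith) h1.le))
    (Set.mem_Ici.2 (show 0 ≤ (1 - 0) / (1 - p) from div_nonneg (by linarith) h1.le))
    (sub_nonneg.2 hδ1) hδ0 (sub_add_cancel 1 δ)
  simp only [smul_eq_mul] at c1 c2
  have e1 : (1 - δ) * (s * p / p) + δ * (0 / p) = (1 - δ) * s * p / p := by ring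
  have e2 : (1 - δ) * ((1 - s * p) / (1 - p)) + δ * ((1 - 0) / (1 - p)) =
      (1 - (1 - δ) * s * p) / (1 - p) := by ring
  rw [e1] at c1
  rw [e2] at c2
  have z := bernoulliKL_zero_le hp0 hp2
  have n : 0 ≤ bernoulliKL p (s * p) := bernoulliKL_nonneg hp0 (by linarith) (by positivity) hsp.le
  have b : bernoulliKL p ((1 - δ) * s * p) ≤
      (1 - δ) * bernoulliKL p (s * p) + δ * bernoulliKL p 0 := by
    rw [e, e (s * p), e 0]
    nlinarith [mul_le_mul_of_nonneg_left c1 hp0.le, mul_le_mul_of_nonneg_left c2 h1.le]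
  nlinarith [mul_le_mul_of_nonneg_left z hδ0, mul_nonneg hδ0 n]

/-! ### Gibbs' inequality and change of measure -/

theorem mul_log_div_le {a b : ℝ} (ha : 0 < a) (hb : 0 < b) :
    a * (Real.log b - Real.log a) ≤ b - a := by
  rw [← Real.log_div hb.ne' ha.ne']
  have := mul_le_mul_of_nonneg_left (Real.log_le_sub_one_of_pos (div_pos hb ha)) ha.le
  rwa [mul_sub, mul_div_cancel₀ _ ha.ne', mul_one] at this

theorem constWeight_pos {N : ℕ} {p : ℝ} (hp0 : 0 < p) (hp1 : p < 1) (G : SimpleGraph (Fin N)) :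
    0 < graphWeight (fun _ => p) G :=
  graphWeight_pos G (fun _ _ _ => hp0) (fun _ _ _ => hp1)

open Classical in
/-- The conditional probability that `e` is an edge of `G(N,p)`, given that the graph is in `K`. -/
def edgeMean {N : ℕ} (p : ℝ) (K : Finset (SimpleGraph (Fin N))) (e : Sym2 (Fin N)) : ℝ :=
  ∑ G ∈ K, graphWeight (fun _ => p) G / (∑ H ∈ K, graphWeight (fun _ => p) H) *
    (if e ∈ G.edgeSet then 1 else 0)

/-- Gibbs' inequality compares the conditional law `m` on `K` with the product measure of the same
marginals `y`. Logarithms of product weights are sums over edges, so their `m`-averages depend on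
`y` alone. -/
theorem log_sum_graphWeight_le {N : ℕ} {p : ℝ} (hp0 : 0 < p) (hp1 : p < 1)
    {K : Finset (SimpleGraph (Fin N))} (hK : K.Nonempty) :
    Real.log (∑ G ∈ K, graphWeight (fun _ => p) G) ≤
      -∑ e ∈ pairs N, bernoulliKL p (edgeMean p K e) := by
  classical
  set P := ∑ G ∈ K, graphWeight (fun _ => p) G with hP
  have hw : ∀ G : SimpleGraph (Fin N), 0 < graphWeight (fun _ => p) G := constWeight_pos hp0 hp1
  have hPpos : 0 < P := Finset.sum_pos (fun G _ => hw G) hK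
  set m : SimpleGraph (Fin N) → ℝ := fun G => graphWeight (fun _ => p) G / P with hm
  have hmpos : ∀ G, 0 < m G := fun G => div_pos (hw G) hPpos
  have hmsum : ∑ G ∈ K, m G = 1 := by
    rw [← Finset.sum_div, div_self hPpos.ne']
  set y := edgeMean p K with hy
  have hy_eq : ∀ e, y e = ∑ G ∈ K, m G * (if e ∈ G.edgeSet then 1 else 0) := fun e => rfl
  have hy_eq' : ∀ e, 1 - y e = ∑ G ∈ K, m G * (if e ∈ G.edgeSet then 0 else 1) := by
    intro e
    have h : 1 - y e = ∑ G ∈ K, m G - y e := by rw [hmsum]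
    rw [h, hy_eq, ← Finset.sum_sub_distrib]
    refine Finset.sum_congr rfl fun G _ => ?_
    split_ifs <;> ring
  have hy0 : ∀ e, 0 ≤ y e := by
    intro e
    rw [hy_eq]
    refine Finset.sum_nonneg fun G _ => mul_nonneg (hmpos G).le ?_
    split_ifs <;> norm_num
  have hy1 : ∀ e, y e ≤ 1 := by
    intro e
    have : 0 ≤ 1 - y e := by
      rw [hy_eq']
      refine Finset.sum_nonneg fun G _ => mul_nonneg (hmpos G).le ?_
      split_ifs <;> norm_num
    linarith
  -- `y` may take the values `0` and `1`, but every edge state of a graph in `K` has positive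
  -- conditional probability, so the logarithms below split.
  have hyw : ∀ G ∈ K, 0 < graphWeight y G := by
    intro G hG
    refine graphWeight_pos G (fun e _ he => ?_) (fun e _ he => ?_)
    · rw [hy_eq]
      refine Finset.sum_pos' (fun H _ => mul_nonneg (hmpos H).le ?_) ⟨G, hG, ?_⟩
      · split_ifs <;> norm_num
      · simp [he, hmpos G]
    · have : 0 < 1 - y e := by
        rw [hy_eq']
        refine Finset.sum_pos' (fun H _ => mul_nonneg (hmpos H).le ?_) ⟨G, hG, ?_⟩
        · split_ifs <;> norm_num
        · simp [he, hmpos G]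
      linarith
  have gibbs : ∑ G ∈ K, m G * (Real.log (graphWeight y G) - Real.log (m G)) ≤ 0 := by
    calc _ ≤ ∑ G ∈ K, (graphWeight y G - m G) :=
          Finset.sum_le_sum fun G hG => mul_log_div_le (hmpos G) (hyw G hG)
      _ = ∑ G ∈ K, graphWeight y G - 1 := by rw [Finset.sum_sub_distrib, hmsum]
      _ ≤ ∑ G, graphWeight y G - 1 := by
          gcongr
          · exact fun G _ _ => graphWeight_nonneg hy0 hy1 G
          · exact Finset.subset_univ K
      _ = 0 := by rw [sum_graphWeight, sub_self]
  have key : ∑ G ∈ K, m G * (Real.log (graphWeight y G) - Real.log (m G)) =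
      ∑ e ∈ pairs N, bernoulliKL p (y e) + Real.log P := by
    have h1 : ∀ G ∈ K, m G * (Real.log (graphWeight y G) - Real.log (m G)) =
        ∑ e ∈ pairs N, (m G * (if e ∈ G.edgeSet then 1 else 0) * (Real.log (y e) - Real.log p) +
          m G * (if e ∈ G.edgeSet then 0 else 1) * (Real.log (1 - y e) - Real.log (1 - p)))
        + m G * Real.log P := by
      intro G hG
      rw [hm]
      dsimp only
      rw [Real.log_div (hw G).ne' hPpos.ne', log_graphWeight G (hyw G hG).ne',
        log_graphWeight G (hw G).ne']
      rw [show ∀ a b c d : ℝ, d * (a - (b - c)) = d * (a - b) + d * c by intros; ring,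
        ← Finset.sum_sub_distrib, Finset.mul_sum]
      congr 1
      refine Finset.sum_congr rfl fun e _ => ?_
      split_ifs <;> ring
    rw [Finset.sum_congr rfl h1, Finset.sum_add_distrib, ← Finset.sum_mul, hmsum, one_mul,
      Finset.sum_comm]
    congr 1
    refine Finset.sum_congr rfl fun e _ => ?_
    rw [Finset.sum_add_distrib, ← Finset.sum_mul, ← Finset.sum_mul, ← hy_eq, ← hy_eq',
      bernoulliKL_eq_sub hp0.ne' (by linarith)]
  linarith

/-- Change of measure from `G(N,p)` to `G(N,q)`. -/
theorem mul_log_sum_graphWeight_le {N : ℕ} {p q : ℝ} (hp0 : 0 < p) (hp1 : p < 1)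
    (hq0 : 0 < q) (hq1 : q < 1) {K : Finset (SimpleGraph (Fin N))} (hK : K.Nonempty) :
    (∑ G ∈ K, graphWeight (fun _ => q) G) * (Real.log (∑ G ∈ K, graphWeight (fun _ => q) G) -
        Real.log (∑ G ∈ K, graphWeight (fun _ => p) G)) ≤
      (N.choose 2 : ℝ) * bernoulliKL p q + 1 := by
  classical
  have hw : ∀ G : SimpleGraph (Fin N), 0 < graphWeight (fun _ => p) G := constWeight_pos hp0 hp1
  have hv : ∀ G : SimpleGraph (Fin N), 0 < graphWeight (fun _ => q) G := constWeight_pos hq0 hq1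
  set P := ∑ G ∈ K, graphWeight (fun _ => p) G with hP
  set Q := ∑ G ∈ K, graphWeight (fun _ => q) G with hQ
  have hPpos : 0 < P := Finset.sum_pos (fun G _ => hw G) hK
  have hQpos : 0 < Q := Finset.sum_pos (fun G _ => hv G) hK
  let f : SimpleGraph (Fin N) → ℝ := fun G => graphWeight (fun _ => q) G *
    (Real.log (graphWeight (fun _ => p) G) - Real.log (graphWeight (fun _ => q) G))
  -- Over all graphs this is minus the relative entropy of `G(N,q)` with respect to `G(N,p)`.
  have total : ∑ G, f G = -((N.choose 2 : ℝ) * bernoulliKL p q) := by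
    have h1 : ∀ G, f G = ∑ e ∈ pairs N, graphWeight (fun _ => q) G *
        (if e ∈ G.edgeSet then Real.log p - Real.log q
          else Real.log (1 - p) - Real.log (1 - q)) := by
      intro G
      simp only [f]
      rw [log_graphWeight G (hw G).ne', log_graphWeight G (hv G).ne', ← Finset.sum_sub_distrib,
        Finset.mul_sum]
      refine Finset.sum_congr rfl fun e _ => ?_
      split_ifs <;> ring
    rw [Finset.sum_congr rfl fun G _ => h1 G, Finset.sum_comm,
      Finset.sum_congr rfl fun e he => sum_graphWeight_edge _ he _ _, Finset.sum_const,
      card_pairs, nsmul_eq_mul, bernoulliKL_eq_sub hp0.ne' (by linarith)]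
    ring
  -- Outside `K` the contribution is at most the `p`-mass: this is the additive `1` in the
  -- conclusion.
  have compl : ∑ G ∈ Kᶜ, f G ≤ 1 := by
    calc ∑ G ∈ Kᶜ, f G ≤ ∑ G ∈ Kᶜ, graphWeight (fun _ => p) G := by
          refine Finset.sum_le_sum fun G _ => ?_
          linarith [mul_log_div_le (hv G) (hw G), hv G]
      _ ≤ ∑ G, graphWeight (fun _ => p) G :=
          Finset.sum_le_sum_of_subset_of_nonneg (Finset.subset_univ _) fun G _ _ => (hw G).le
      _ = 1 := sum_graphWeight _
  -- The log-sum inequality on `K`: the `p`-weights are rescaled by `Q / P` to have the same mass on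
  -- `K` as the `q`-weights.
  have main : ∑ G ∈ K, f G ≤ Q * (Real.log P - Real.log Q) := by
    have h1 : ∑ G ∈ K, graphWeight (fun _ => q) G *
        (Real.log (graphWeight (fun _ => p) G * (Q / P)) - Real.log (graphWeight (fun _ => q) G)) ≤
        ∑ G ∈ K, (graphWeight (fun _ => p) G * (Q / P) - graphWeight (fun _ => q) G) :=
      Finset.sum_le_sum fun G _ => mul_log_div_le (hv G) (mul_pos (hw G) (div_pos hQpos hPpos))
    rw [Finset.sum_sub_distrib, ← Finset.sum_mul, ← hP, ← hQ, mul_div_cancel₀ _ hPpos.ne',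
      sub_self] at h1
    have h2 : ∑ G ∈ K, graphWeight (fun _ => q) G *
        (Real.log (graphWeight (fun _ => p) G * (Q / P)) - Real.log (graphWeight (fun _ => q) G)) =
        ∑ G ∈ K, f G + Q * (Real.log Q - Real.log P) := by
      rw [hQ, Finset.sum_mul, ← Finset.sum_add_distrib]
      refine Finset.sum_congr rfl fun G _ => ?_
      rw [← hQ, Real.log_mul (hw G).ne' (div_pos hQpos hPpos).ne',
        Real.log_div hQpos.ne' hPpos.ne']
      simp only [f]
      ring
    linarith
  have split := Finset.sum_add_sum_compl K f
  linarith

/-! ### Schatten norms: Schur's theorem, convexity, traces -/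

section Schatten

open Matrix

section Hermitian

variable {n : Type*} [Fintype n]

theorem inner_eq_dotProduct (x y : EuclideanSpace ℝ n) : inner ℝ x y = x.ofLp ⬝ᵥ y.ofLp := by
  rw [EuclideanSpace.inner_eq_star_dotProduct, star_trivial, dotProduct_comm]

variable [DecidableEq n]

theorem dotProduct_mulVec_eq_sum {B : Matrix n n ℝ} (hB : B.IsHermitian)
    (v : EuclideanSpace ℝ n) :
    v.ofLp ⬝ᵥ (B *ᵥ v.ofLp) = ∑ i, inner ℝ (hB.eigenvectorBasis i) v ^ 2 * hB.eigenvalues i := by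
  have hsymm : Bᵀ = B := by
    rw [← conjTranspose_eq_transpose_of_trivial]
    exact hB
  have h := hB.eigenvectorBasis.sum_inner_mul_inner v (WithLp.toLp 2 (B *ᵥ v.ofLp))
  rw [inner_eq_dotProduct] at h
  rw [← h]
  refine Finset.sum_congr rfl fun i _ => ?_
  have h2 : inner ℝ (hB.eigenvectorBasis i) (WithLp.toLp 2 (B *ᵥ v.ofLp)) =
      hB.eigenvalues i * inner ℝ (hB.eigenvectorBasis i) v := by
    rw [inner_eq_dotProduct, inner_eq_dotProduct, dotProduct_mulVec, ← mulVec_transpose, hsymm,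
      hB.mulVec_eigenvectorBasis, smul_dotProduct, smul_eq_mul]
  rw [h2, real_inner_comm]
  ring

/-- By Birkhoff's theorem the matrix is an average of permutation matrices, and these are isometries
of `ℓ^α`. -/
theorem norm_doublyStochastic_mulVec_le (α : ℝ≥0∞) [Fact (1 ≤ α)] {D : Matrix n n ℝ}
    (hD : D ∈ doublyStochastic ℝ n) (x : n → ℝ) :
    ‖WithLp.toLp α (D *ᵥ x)‖ ≤ ‖WithLp.toLp α x‖ := by
  obtain ⟨w, hw0, hw1, rfl⟩ := exists_eq_sum_perm_of_mem_doublyStochastic hD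
  have hperm : ∀ σ : Equiv.Perm n, ‖WithLp.toLp α (x ∘ σ)‖ = ‖WithLp.toLp α x‖ := by
    intro σ
    rw [← (LinearIsometryEquiv.piLpCongrLeft α ℝ ℝ σ).norm_map (WithLp.toLp α (x ∘ σ))]
    congr 1
    ext i
    simp [LinearIsometryEquiv.piLpCongrLeft_apply, Equiv.piCongrLeft']
  calc ‖WithLp.toLp α ((∑ σ, w σ • Equiv.Perm.permMatrix ℝ σ) *ᵥ x)‖
      = ‖∑ σ, w σ • WithLp.toLp α (x ∘ σ)‖ := by
        congr 1
        rw [Matrix.sum_mulVec, WithLp.toLp_sum]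
        refine Finset.sum_congr rfl fun σ _ => ?_
        rw [Matrix.smul_mulVec, Matrix.permMatrix_mulVec, WithLp.toLp_smul]
    _ ≤ ∑ σ, ‖w σ • WithLp.toLp α (x ∘ σ)‖ := norm_sum_le _ _
    _ = ∑ σ, w σ * ‖WithLp.toLp α x‖ := by
        refine Finset.sum_congr rfl fun σ _ => ?_
        rw [norm_smul, hperm, Real.norm_of_nonneg (hw0 σ)]
    _ = ‖WithLp.toLp α x‖ := by rw [← Finset.sum_mul, hw1, one_mul]

/-- The diagonal of a Hermitian matrix in any orthonormal basis has an `ℓ^α` norm at most the one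
of the eigenvalues. -/
theorem norm_diag_le (α : ℝ≥0∞) [Fact (1 ≤ α)] {B : Matrix n n ℝ} (hB : B.IsHermitian)
    (v : OrthonormalBasis n ℝ (EuclideanSpace ℝ n)) :
    ‖WithLp.toLp α (fun j => (v j).ofLp ⬝ᵥ (B *ᵥ (v j).ofLp))‖ ≤
      ‖WithLp.toLp α hB.eigenvalues‖ := by
  -- The squared overlaps of two orthonormal bases are doubly stochastic, by Parseval in either
  -- basis.
  let D : Matrix n n ℝ := fun j i => inner ℝ (hB.eigenvectorBasis i) (v j) ^ 2
  have hD : D ∈ doublyStochastic ℝ n := by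
    rw [mem_doublyStochastic_iff_sum]
    refine ⟨fun i j => sq_nonneg _, fun j => ?_, fun i => ?_⟩
    · simp only [D]
      rw [OrthonormalBasis.sum_sq_inner_right, v.norm_eq_one, one_pow]
    · simp only [D]
      simp_rw [real_inner_comm]
      rw [OrthonormalBasis.sum_sq_inner_right, OrthonormalBasis.norm_eq_one, one_pow]
  have h : (fun j => (v j).ofLp ⬝ᵥ (B *ᵥ (v j).ofLp)) = D *ᵥ hB.eigenvalues := by
    ext j
    rw [dotProduct_mulVec_eq_sum hB]
    rfl
  rw [h]
  exact norm_doublyStochastic_mulVec_le α hD _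

theorem eigenvalues_eq_dotProduct {B : Matrix n n ℝ} (hB : B.IsHermitian) (j : n) :
    hB.eigenvalues j =
      (hB.eigenvectorBasis j).ofLp ⬝ᵥ (B *ᵥ (hB.eigenvectorBasis j).ofLp) := by
  rw [hB.mulVec_eigenvectorBasis, dotProduct_smul, ← inner_eq_dotProduct,
    real_inner_self_eq_norm_sq, OrthonormalBasis.norm_eq_one]
  simp

/-- Convexity of the Schatten norms. -/
theorem norm_eigenvalues_sum_le (α : ℝ≥0∞) [Fact (1 ≤ α)] {ι : Type*} (s : Finset ι) {w : ι → ℝ}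
    (hw : ∀ k ∈ s, 0 ≤ w k) {A : ι → Matrix n n ℝ} (hA : ∀ k, (A k).IsHermitian)
    {B : Matrix n n ℝ} (hB : B.IsHermitian) (hBA : B = ∑ k ∈ s, w k • A k) :
    ‖WithLp.toLp α hB.eigenvalues‖ ≤ ∑ k ∈ s, w k * ‖WithLp.toLp α (hA k).eigenvalues‖ := by
  -- In the eigenbasis of `B`, the eigenvalues of `B` are the same combination of the diagonals of
  -- the `A k`; `norm_diag_le` controls each diagonal.
  have h : WithLp.toLp α hB.eigenvalues = ∑ k ∈ s, w k • WithLp.toLp α (fun j =>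
      (hB.eigenvectorBasis j).ofLp ⬝ᵥ (A k *ᵥ (hB.eigenvectorBasis j).ofLp)) := by
    rw [← Finset.sum_congr rfl fun k _ => WithLp.toLp_smul (p := α) (w k) _, ← WithLp.toLp_sum]
    congr 1
    ext j
    rw [eigenvalues_eq_dotProduct]
    simp only [Finset.sum_apply, Pi.smul_apply]
    generalize (hB.eigenvectorBasis j).ofLp = u
    rw [hBA, Matrix.sum_mulVec, dotProduct_sum]
    refine Finset.sum_congr rfl fun k _ => ?_
    rw [Matrix.smul_mulVec, dotProduct_smul]
  rw [h]
  refine (norm_sum_le _ _).trans (Finset.sum_le_sum fun k hk => ?_)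
  rw [norm_smul, Real.norm_of_nonneg (hw k hk)]
  exact mul_le_mul_of_nonneg_left (norm_diag_le α (hA k) _) (hw k hk)

/-- Every `ℓ^α` norm of the spectrum dominates the largest eigenvalue. -/
theorem dotProduct_mulVec_le (α : ℝ≥0∞) [Fact (1 ≤ α)] {B : Matrix n n ℝ} (hB : B.IsHermitian)
    (v : EuclideanSpace ℝ n) :
    v.ofLp ⬝ᵥ (B *ᵥ v.ofLp) ≤ ‖v‖ ^ 2 * ‖WithLp.toLp α hB.eigenvalues‖ := by
  rw [dotProduct_mulVec_eq_sum hB, ← hB.eigenvectorBasis.sum_sq_inner_right v, Finset.sum_mul]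
  refine Finset.sum_le_sum fun i _ => mul_le_mul_of_nonneg_left ?_ (sq_nonneg _)
  exact (le_abs_self _).trans (PiLp.norm_apply_le (WithLp.toLp α hB.eigenvalues) i)

theorem trace_pow_eq_sum_eigenvalues {B : Matrix n n ℝ} (hB : B.IsHermitian) (m : ℕ) :
    (B ^ m).trace = ∑ i, hB.eigenvalues i ^ m := by
  conv_lhs => rw [hB.spectral_theorem, ← map_pow, Matrix.diagonal_pow,
    Unitary.conjStarAlgAut_apply, Matrix.trace_mul_cycle]
  rw [Unitary.coe_star_mul_self, one_mul, Matrix.trace_diagonal]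
  simp

end Hermitian

/-! ### `ℓ^α` norms and even power sums -/

section Lp

variable {n : Type*} [Fintype n]

theorem norm_toLp_le_sum (α : ℝ≥0∞) [Fact (1 ≤ α)] (x : n → ℝ) :
    ‖WithLp.toLp α x‖ ≤ ∑ i, |x i| := by
  classical
  have h : WithLp.toLp α x = ∑ i, PiLp.single α i (x i) := by
    ext j
    simp [Pi.single_apply]
  rw [h]
  refine (norm_sum_le _ _).trans (Finset.sum_le_sum fun i _ => ?_)
  rw [PiLp.norm_single, Real.norm_eq_abs]

/-- The power mean inequality between the exponents `α` and `2 * k`, with uniform weights. -/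
theorem norm_toLp_le_of_sum_pow_le {α : ℝ≥0∞} (hα1 : 1 ≤ α) (hα : α ≠ ∞) [Nonempty n] {k : ℕ}
    (hk : α.toReal ≤ 2 * k) {x : n → ℝ} {b : ℝ} (hb : 0 ≤ b)
    (h : ∑ i, x i ^ (2 * k) ≤ Fintype.card n * b ^ (2 * k)) :
    ‖WithLp.toLp α x‖ ≤ (Fintype.card n : ℝ) ^ (1 / α.toReal) * b := by
  have ha1 : 1 ≤ α.toReal := by
    rw [← ENNReal.toReal_one]
    exact ENNReal.toReal_mono hα hα1
  have ha : 0 < α.toReal := by linarith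
  rw [PiLp.norm_eq_sum ha]
  set a := α.toReal
  have hc : (0 : ℝ) < Fintype.card n := by exact_mod_cast Fintype.card_pos
  have hr : 1 ≤ 2 * (k : ℝ) / a := by rwa [le_div_iff₀ ha, one_mul]
  have hpm := Real.rpow_arith_mean_le_arith_mean_rpow Finset.univ
    (fun _ : n => (Fintype.card n : ℝ)⁻¹) (fun i => |x i| ^ a) (fun _ _ => by positivity)
    (by simp [hc.ne']) (fun _ _ => by positivity) hr
  rw [← Finset.mul_sum, ← Finset.mul_sum] at hpm
  have e1 : ∀ i, (|x i| ^ a) ^ (2 * (k : ℝ) / a) = x i ^ (2 * k) := by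
    intro i
    rw [← Real.rpow_mul (abs_nonneg _), mul_div_cancel₀ _ ha.ne']
    have : (2 * (k : ℝ)) = ((2 * k : ℕ) : ℝ) := by push_cast; ring
    rw [this, Real.rpow_natCast, pow_mul, sq_abs, ← pow_mul]
  have e2 : (b ^ a) ^ (2 * (k : ℝ) / a) = b ^ (2 * k) := by
    rw [← Real.rpow_mul hb, mul_div_cancel₀ _ ha.ne']
    have : (2 * (k : ℝ)) = ((2 * k : ℕ) : ℝ) := by push_cast; ring
    rw [this, Real.rpow_natCast]
  simp only [e1] at hpm
  have h3 : (Fintype.card n : ℝ)⁻¹ * ∑ i, |x i| ^ a ≤ b ^ a := by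
    rw [← Real.rpow_le_rpow_iff (z := 2 * (k : ℝ) / a) (by positivity) (by positivity)
      (by linarith), e2]
    refine hpm.trans ?_
    rw [inv_mul_le_iff₀ hc]
    exact h
  rw [inv_mul_le_iff₀ hc] at h3
  calc (∑ i, ‖x i‖ ^ a) ^ (1 / a) ≤ (Fintype.card n * b ^ a) ^ (1 / a) := by
        refine Real.rpow_le_rpow (by positivity) ?_ (by positivity)
        simpa only [Real.norm_eq_abs] using h3
    _ = (Fintype.card n : ℝ) ^ (1 / a) * b := by
        rw [Real.mul_rpow hc.le (by positivity), ← Real.rpow_mul hb, mul_one_div_cancel ha.ne',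
          Real.rpow_one]

theorem norm_toLp_top_le_of_sum_pow_le {k : ℕ} (hk : k ≠ 0) {x : n → ℝ} {b : ℝ} (hb : 0 ≤ b)
    (h : ∑ i, x i ^ (2 * k) ≤ b ^ (2 * k)) :
    ‖WithLp.toLp ∞ x‖ ≤ b := by
  rw [PiLp.norm_eq_ciSup]
  refine Real.iSup_le (fun i => ?_) hb
  have h1 : x i ^ (2 * k) ≤ b ^ (2 * k) :=
    (Finset.single_le_sum (f := fun i => x i ^ (2 * k))
      (fun i _ => by rw [pow_mul]; positivity) (Finset.mem_univ i)).trans h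
  have h2 : |x i| ^ (2 * k) = x i ^ (2 * k) := by rw [pow_mul, sq_abs, ← pow_mul]
  rw [← h2] at h1
  exact (pow_le_pow_iff_left₀ (abs_nonneg _) hb (by omega)).1 h1

end Lp

end Schatten

/-! ### The upper bounds -/

theorem entropy_nonneg {N : ℕ} {p : ℝ} (hp0 : 0 < p) (hp1 : p < 1) (X : cX N) :
    0 ≤ entropy p X :=
  Finset.sum_nonneg fun i _ => Finset.sum_nonneg fun j _ =>
    bernoulliKL_nonneg hp0 hp1 (X.2.2.2 i j).1 (X.2.2.2 i j).2

theorem bddBelow_entropy_image {N : ℕ} {p : ℝ} (hp0 : 0 < p) (hp1 : p < 1) (S : Set (cX N)) :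
    BddBelow (entropy p '' S) := by
  refine ⟨0, ?_⟩
  rintro _ ⟨X, _, rfl⟩
  exact entropy_nonneg hp0 hp1 X

theorem schattenNorm_zero {N : ℕ} (α : ℝ≥0∞) [Fact (1 ≤ α)]
    (h : (0 : Matrix (Fin N) (Fin N) ℝ) ∈ cX N) :
    schattenNorm α ⟨0, h⟩ = 0 := by
  rw [schattenNorm, (cX_isHermitian ⟨0, h⟩).eigenvalues_eq_zero_iff.2 rfl, WithLp.toLp_zero,
    norm_zero]

theorem zero_mem_cX (N : ℕ) : (0 : Matrix (Fin N) (Fin N) ℝ) ∈ cX N :=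
  ⟨Matrix.transpose_zero, fun _ => rfl, fun _ _ => ⟨le_rfl, zero_le_one⟩⟩

theorem edgeMean_mem_Icc {N : ℕ} {p : ℝ} (hp0 : 0 < p) (hp1 : p < 1)
    {K : Finset (SimpleGraph (Fin N))} (hK : K.Nonempty) (e : Sym2 (Fin N)) :
    edgeMean p K e ∈ Set.Icc (0 : ℝ) 1 := by
  classical
  have hw : ∀ G : SimpleGraph (Fin N), 0 < graphWeight (fun _ => p) G := constWeight_pos hp0 hp1
  have hP : 0 < ∑ G ∈ K, graphWeight (fun _ => p) G := Finset.sum_pos (fun G _ => hw G) hK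
  constructor
  · refine Finset.sum_nonneg fun G _ => mul_nonneg (div_pos (hw G) hP).le ?_
    split_ifs <;> norm_num
  · calc edgeMean p K e ≤ ∑ G ∈ K, graphWeight (fun _ => p) G /
          (∑ H ∈ K, graphWeight (fun _ => p) H) * 1 := by
          refine Finset.sum_le_sum fun G _ => mul_le_mul_of_nonneg_left ?_ (div_pos (hw G) hP).le
          split_ifs <;> norm_num
      _ = 1 := by simp_rw [mul_one]; rw [← Finset.sum_div, div_self (ne_of_gt hP)]

/-- The conditional mean of the adjacency matrix of `G(N,p)`, given that the graph is in `K`. -/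
def meanMatrix {N : ℕ} (p : ℝ) (K : Finset (SimpleGraph (Fin N))) : Matrix (Fin N) (Fin N) ℝ :=
  Matrix.of fun i j => edgeMean p K s(i, j)

theorem meanMatrix_mem_cX {N : ℕ} {p : ℝ} (hp0 : 0 < p) (hp1 : p < 1)
    {K : Finset (SimpleGraph (Fin N))} (hK : K.Nonempty) : meanMatrix p K ∈ cX N := by
  refine ⟨?_, fun i => ?_, fun i j => edgeMean_mem_Icc hp0 hp1 hK _⟩
  · ext i j
    simp [meanMatrix, Sym2.eq_swap]
  · simp [meanMatrix, edgeMean]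

theorem meanMatrix_eq_sum {N : ℕ} (p : ℝ) (K : Finset (SimpleGraph (Fin N))) :
    meanMatrix p K = ∑ G ∈ K, (graphWeight (fun _ => p) G /
      (∑ H ∈ K, graphWeight (fun _ => p) H)) • (adj G : Matrix (Fin N) (Fin N) ℝ) := by
  ext i j
  rw [Matrix.sum_apply]
  refine Finset.sum_congr rfl fun G _ => ?_
  simp only [adj, Matrix.smul_apply, SimpleGraph.adjMatrix_apply, smul_eq_mul]
  congr 1

theorem entropy_meanMatrix {N : ℕ} {p : ℝ} {K : Finset (SimpleGraph (Fin N))}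
    (h : meanMatrix p K ∈ cX N) :
    entropy p ⟨meanMatrix p K, h⟩ = ∑ e ∈ pairs N, bernoulliKL p (edgeMean p K e) := by
  rw [sum_pairs]
  rfl

/-- The conditional mean matrix is a convex combination of adjacency matrices in the sublevel set,
hence a competitor, and `log_sum_graphWeight_le` bounds the probability by its entropy. -/
theorem lowerTail_le_exp_neg_psi {α : ℝ≥0∞} (hα : 1 ≤ α) {N : ℕ} {p : unitInterval}
    (hp0 : 0 < (p : ℝ)) (hp1 : (p : ℝ) < 1) (t : ℝ) :
    lowerTail α N p t ≤ Real.exp (-psi (N := N) (schattenNorm α) p t) := by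
  classical
  have : Fact (1 ≤ α) := ⟨hα⟩
  rw [lowerTail, binomialRandom_real]
  set K : Finset (SimpleGraph (Fin N)) := Finset.univ.filter
    (fun G => G ∈ {G | schattenNorm α (adj G) ≤ t}) with hKdef
  rcases K.eq_empty_or_nonempty with hK | hK
  · rw [hK, Finset.sum_empty]
    exact (Real.exp_pos _).le
  have hw : ∀ G : SimpleGraph (Fin N), 0 < graphWeight (fun _ => (p : ℝ)) G :=
    constWeight_pos hp0 hp1
  have hP : 0 < ∑ G ∈ K, graphWeight (fun _ => (p : ℝ)) G := Finset.sum_pos (fun G _ => hw G) hK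
  rw [← Real.log_le_iff_le_exp hP]
  refine (log_sum_graphWeight_le hp0 hp1 hK).trans (neg_le_neg ?_)
  have hX := meanMatrix_mem_cX hp0 hp1 hK
  rw [← entropy_meanMatrix hX]
  refine csInf_le (bddBelow_entropy_image hp0 hp1 _) ⟨_, ?_, rfl⟩
  have h := norm_eigenvalues_sum_le α K (fun G _ => (div_pos (hw G) hP).le)
    (fun G => cX_isHermitian (adj G)) (cX_isHermitian ⟨_, hX⟩) (meanMatrix_eq_sum (p : ℝ) K)
  refine h.trans ?_
  calc _ ≤ ∑ G ∈ K, graphWeight (fun _ => (p : ℝ)) G /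
        (∑ H ∈ K, graphWeight (fun _ => (p : ℝ)) H) * t := by
        refine Finset.sum_le_sum fun G hG => mul_le_mul_of_nonneg_left ?_ (div_pos (hw G) hP).le
        exact (Finset.mem_filter.1 hG).2
    _ = t := by rw [← Finset.sum_mul, ← Finset.sum_div, div_self hP.ne', one_mul]

theorem sum_sum_eq_two_mul {N : ℕ} {X : Matrix (Fin N) (Fin N) ℝ} (hX : X ∈ cX N) :
    ∑ i, ∑ j, X i j = 2 * ∑ i, ∑ j ∈ Finset.Ioi i, X i j := by
  have h1 : ∀ i, ∑ j, X i j = ∑ j ∈ Finset.Ioi i, X i j + ∑ j ∈ Finset.Iio i, X i j := by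
    intro i
    have hu : (Finset.univ : Finset (Fin N)) = insert i (Finset.Ioi i ∪ Finset.Iio i) := by
      ext j
      simp only [Finset.mem_univ, Finset.mem_insert, Finset.mem_union, Finset.mem_Ioi,
        Finset.mem_Iio, true_iff]
      rcases lt_trichotomy i j with h | h | h
      · exact Or.inr (Or.inl h)
      · exact Or.inl h.symm
      · exact Or.inr (Or.inr h)
    rw [hu, Finset.sum_insert (by simp), hX.2.1, zero_add, Finset.sum_union]
    rw [Finset.disjoint_left]
    intro j h h'
    exact lt_asymm (Finset.mem_Ioi.1 h) (Finset.mem_Iio.1 h')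
  have h2 : ∑ i, ∑ j ∈ Finset.Iio i, X i j = ∑ i, ∑ j ∈ Finset.Ioi i, X i j := by
    refine (Finset.sum_comm' (s' := fun j => Finset.Ioi j) (t' := Finset.univ) (by simp)).trans ?_
    refine Finset.sum_congr rfl fun i _ => Finset.sum_congr rfl fun j _ => ?_
    exact hX.1.apply i j
  rw [Finset.sum_congr rfl fun i _ => h1 i, Finset.sum_add_distrib, h2]
  ring

/-- The quadratic form at the all-ones vector, of squared norm `N`, is twice the sum over pairs. -/
theorem sum_Ioi_le_of_schattenNorm_le {α : ℝ≥0∞} (hα : 1 ≤ α) {N : ℕ} {q : ℝ} {X : cX N}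
    (hX : schattenNorm α X ≤ q * ((N : ℝ) - 1)) :
    ∑ i, ∑ j ∈ Finset.Ioi i, (X : Matrix (Fin N) (Fin N) ℝ) i j ≤ q * N.choose 2 := by
  have : Fact (1 ≤ α) := ⟨hα⟩
  have h := dotProduct_mulVec_le α (cX_isHermitian X) (WithLp.toLp 2 fun _ => 1)
  have e1 : (fun _ : Fin N => (1 : ℝ)) ⬝ᵥ ((X : Matrix (Fin N) (Fin N) ℝ).mulVec fun _ => 1) =
      ∑ i, ∑ j, (X : Matrix (Fin N) (Fin N) ℝ) i j := by
    simp [dotProduct, Matrix.mulVec]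
  have e2 : ‖(WithLp.toLp 2 fun _ => 1 : EuclideanSpace ℝ (Fin N))‖ ^ 2 = N := by
    rw [EuclideanSpace.norm_sq_eq]
    simp
  rw [e1, e2, sum_sum_eq_two_mul X.2] at h
  have h2 := h.trans (mul_le_mul_of_nonneg_left hX (Nat.cast_nonneg N))
  rw [Nat.cast_choose_two]
  linarith

/-- The tangent to `I_p` at `q` has slope `c ≤ 0` because `q < p`, and the entries average at most
`q`; summing the tangent bounds gives the claim. -/
theorem exp_neg_psi_le {α : ℝ≥0∞} (hα : 1 ≤ α) {N : ℕ} (hN : 1 ≤ N) {p q : ℝ} (hq0 : 0 < q)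
    (hqp : q < p) (hp1 : p < 1) :
    Real.exp (-psi (N := N) (schattenNorm α) p (q * ((N : ℝ) - 1))) ≤
      Real.exp (-((N.choose 2 : ℝ) * bernoulliKL p q)) := by
  have : Fact (1 ≤ α) := ⟨hα⟩
  have hN' : (1 : ℝ) ≤ N := by exact_mod_cast hN
  rw [Real.exp_le_exp, neg_le_neg_iff]
  -- The zero matrix makes the set nonempty, so `sInf` is a true infimum; `1 ≤ N` keeps the
  -- threshold nonnegative.
  refine le_csInf ⟨_, ⟨0, zero_mem_cX N⟩, ?_, rfl⟩ ?_
  · rw [Set.mem_ofPred_eq, schattenNorm_zero]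
    exact mul_nonneg hq0.le (by linarith)
  rintro _ ⟨X, hX, rfl⟩
  have hs := sum_Ioi_le_of_schattenNorm_le hα hX
  set c := Real.log q - Real.log p - (Real.log (1 - q) - Real.log (1 - p)) with hc
  have hc0 : c ≤ 0 := by
    have h1 := Real.log_le_log hq0 hqp.le
    have h2 := Real.log_le_log (show 0 < 1 - p by linarith) (show 1 - p ≤ 1 - q by linarith)
    linarith
  have hcard : ∀ a : ℝ, ∑ i : Fin N, ∑ j ∈ Finset.Ioi i, a = N.choose 2 * a := by
    intro a
    rw [← card_pairs, ← nsmul_eq_mul, ← Finset.sum_const, sum_pairs]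
  have h : ∑ i : Fin N, ∑ j ∈ Finset.Ioi i, (bernoulliKL p q +
      c * ((X : Matrix (Fin N) (Fin N) ℝ) i j - q)) ≤ entropy p X :=
    Finset.sum_le_sum fun i _ => Finset.sum_le_sum fun j _ =>
      bernoulliKL_tangent (hq0.trans hqp) hp1 hq0 (hqp.trans hp1) (X.2.2.2 i j).1 (X.2.2.2 i j).2
  simp only [Finset.sum_add_distrib, ← Finset.mul_sum, Finset.sum_sub_distrib, hcard] at h
  nlinarith [mul_nonneg (neg_nonneg.2 hc0) (sub_nonneg.2 hs)]

/-! ### Trace moments of the centered adjacency matrix -/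

open Classical in
/-- The centered edge indicator under `G(N,q)`, zero on loops. -/
def edgeDev {N : ℕ} (q : ℝ) (G : SimpleGraph (Fin N)) (e : Sym2 (Fin N)) : ℝ :=
  if e.IsDiag then 0 else if e ∈ G.edgeSet then 1 - q else -q

/-- The centered adjacency matrix. -/
def centered {N : ℕ} (q : ℝ) (G : SimpleGraph (Fin N)) : Matrix (Fin N) (Fin N) ℝ :=
  Matrix.of fun i j => edgeDev q G s(i, j)

theorem centered_isHermitian {N : ℕ} (q : ℝ) (G : SimpleGraph (Fin N)) :
    (centered q G).IsHermitian := by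
  ext i j
  simp [centered, Sym2.eq_swap]

/-- These are the centered moments of a Bernoulli variable: the first vanishes, and the higher ones
are dominated by the variance `q * (1 - q)`. -/
theorem abs_centered_moment_le {q : ℝ} (h0 : 0 ≤ q) (h1 : q ≤ 1) {m : ℕ} (hm : 1 ≤ m) :
    |q * (1 - q) ^ m + (1 - q) * (-q) ^ m| ≤ q := by
  obtain ⟨r, rfl⟩ := Nat.exists_eq_add_of_le' hm
  rcases Nat.eq_zero_or_pos r with rfl | hr
  · have : q * (1 - q) ^ (0 + 1) + (1 - q) * (-q) ^ (0 + 1) = 0 := by ring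
    rw [this, abs_zero]
    exact h0
  · have hq : 0 ≤ 1 - q := by linarith
    have b1 : (1 - q) ^ r ≤ 1 - q := pow_le_of_le_one hq (by linarith) (by omega)
    have b2 : q ^ r ≤ q := pow_le_of_le_one h0 h1 (by omega)
    calc |q * (1 - q) ^ (r + 1) + (1 - q) * (-q) ^ (r + 1)|
        ≤ |q * (1 - q) ^ (r + 1)| + |(1 - q) * (-q) ^ (r + 1)| := abs_add_le _ _
      _ = q * (1 - q) * (1 - q) ^ r + q * (1 - q) * q ^ r := by
          rw [abs_mul, abs_mul, abs_pow, abs_pow, abs_neg, abs_of_nonneg h0, abs_of_nonneg hq]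
          ring
      _ ≤ q * (1 - q) * (1 - q) + q * (1 - q) * q := by
          have := mul_nonneg h0 hq
          gcongr
      _ ≤ q := by nlinarith

/-- Independence factors the expectation over distinct edges. A loop, or an edge occurring once,
gives zero; otherwise each edge occurs at least twice and contributes at most `q`. -/
theorem abs_expect_prod_edgeDev_le {N : ℕ} {q : ℝ} (h0 : 0 ≤ q) (h1 : q ≤ 1)
    (L : List (Sym2 (Fin N))) :
    |∑ G : SimpleGraph (Fin N), graphWeight (fun _ => q) G * (L.map (edgeDev q G)).prod| ≤
      if 2 * L.toFinset.card ≤ L.length then q ^ L.toFinset.card else 0 := by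
  classical
  have hnn : 0 ≤ if 2 * L.toFinset.card ≤ L.length then q ^ L.toFinset.card else 0 := by
    split_ifs <;> positivity
  by_cases hdiag : ∃ e ∈ L, e.IsDiag
  · obtain ⟨e, he, hd⟩ := hdiag
    have : ∀ G : SimpleGraph (Fin N), (L.map (edgeDev q G)).prod = 0 := by
      intro G
      rw [List.prod_eq_zero_iff, List.mem_map]
      exact ⟨e, he, by simp [edgeDev, hd]⟩
    simpa [this] using hnn
  push Not at hdiag
  have hsub : L.toFinset ⊆ pairs N := fun e he => mem_pairs.2 (hdiag e (List.mem_toFinset.1 he))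
  have hprod : ∀ G : SimpleGraph (Fin N), (L.map (edgeDev q G)).prod =
      ∏ e ∈ pairs N, if e ∈ G.edgeSet then (1 - q) ^ L.count e else (-q) ^ L.count e := by
    intro G
    rw [Finset.prod_list_map_count]
    rw [Finset.prod_subset hsub]
    · refine Finset.prod_congr rfl fun e he => ?_
      rw [edgeDev, if_neg (mem_pairs.1 he)]
      split_ifs <;> rfl
    · intro e _ he
      rw [List.count_eq_zero_of_not_mem (by simpa using he), pow_zero]
  simp only [hprod]
  rw [sum_graphWeight_mul_prod (fun _ => q), Finset.abs_prod]
  have hrest : ∏ e ∈ pairs N, |q * (1 - q) ^ L.count e + (1 - q) * (-q) ^ L.count e| =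
      ∏ e ∈ L.toFinset, |q * (1 - q) ^ L.count e + (1 - q) * (-q) ^ L.count e| := by
    symm
    refine Finset.prod_subset hsub fun e _ he => ?_
    rw [List.count_eq_zero_of_not_mem (by simpa using he)]
    simp
  rw [hrest]
  by_cases hone : ∃ e ∈ L.toFinset, L.count e = 1
  · obtain ⟨e, he, hc⟩ := hone
    rw [Finset.prod_eq_zero he]
    · exact hnn
    · rw [hc, abs_eq_zero]
      ring
  push Not at hone
  have hcount : ∀ e ∈ L.toFinset, 2 ≤ L.count e := by
    intro e he
    have := List.count_pos_iff.2 (List.mem_toFinset.1 he)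
    have := hone e he
    omega
  have hlen : 2 * L.toFinset.card ≤ L.length := by
    have := Finset.sum_le_sum hcount
    rw [Finset.sum_const, smul_eq_mul, List.sum_toFinset_count_eq_length] at this
    omega
  rw [if_pos hlen, ← Finset.prod_const]
  refine Finset.prod_le_prod (fun _ _ => abs_nonneg _) fun e he => ?_
  exact abs_centered_moment_le h0 h1 (by have := hcount e he; omega)

/-- At most `k` distinct edges contribute, so replacing `q` by a smaller `z` costs at most `(q / z)
^ k`. The resulting bound needs no multiplicity condition, so walks can be summed one step at a
time. -/
theorem abs_expect_prod_edgeDev_le' {N k : ℕ} {q z : ℝ} (hz : 0 < z) (hzq : z ≤ q) (h1 : q ≤ 1)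
    (L : List (Sym2 (Fin N))) (hL : L.length = 2 * k) :
    |∑ G : SimpleGraph (Fin N), graphWeight (fun _ => q) G * (L.map (edgeDev q G)).prod| ≤
      (q / z) ^ k * z ^ L.toFinset.card := by
  have hq : 0 < q := hz.trans_le hzq
  refine (abs_expect_prod_edgeDev_le hq.le h1 L).trans ?_
  split_ifs with h
  · have hr : 1 ≤ q / z := by rwa [one_le_div hz]
    calc q ^ L.toFinset.card = (q / z) ^ L.toFinset.card * z ^ L.toFinset.card := by
          rw [← mul_pow, div_mul_cancel₀ _ hz.ne']
      _ ≤ (q / z) ^ k * z ^ L.toFinset.card := by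
          gcongr
          omega
  · positivity

/-- Extending a walk: a step either uses a new edge, or one of the edges used before. -/
theorem sum_pow_card_insert_le {N : ℕ} {z : ℝ} (hz : 0 ≤ z) (S : Finset (Sym2 (Fin N)))
    (b : Fin N) :
    ∑ a : Fin N, z ^ (insert s(b, a) S).card ≤ z ^ S.card * (z * N + S.card) := by
  classical
  have h : ∀ a : Fin N, z ^ (insert s(b, a) S).card ≤
      z ^ S.card * (z + if s(b, a) ∈ S then 1 else 0) := by
    intro a
    have := pow_nonneg hz S.card
    split_ifs with ha
    · rw [Finset.insert_eq_of_mem ha]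
      nlinarith
    · rw [Finset.card_insert_of_notMem ha, pow_succ, add_zero]
  refine (Finset.sum_le_sum fun a _ => h a).trans ?_
  rw [← Finset.mul_sum]
  refine mul_le_mul_of_nonneg_left ?_ (pow_nonneg hz _)
  rw [Finset.sum_add_distrib, Finset.sum_const, Finset.card_univ, Fintype.card_fin, nsmul_eq_mul,
    Finset.sum_boole, mul_comm]
  gcongr
  refine Finset.card_le_card_of_injOn (fun a => s(b, a)) ?_ ?_
  · intro a ha
    simpa using ha
  · intro a _ a' _ h
    exact Sym2.congr_right.1 h

/-- Induction on the steps still to come: the first factor of the matrix power is expanded and its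
entry joins the list `L`. Each step costs a factor `z * N + 2 * k`, since `L` never holds more than
`2 * k` edges. -/
theorem abs_expect_prod_mul_pow_le {N k : ℕ} {q z : ℝ} (hz : 0 < z) (hzq : z ≤ q) (h1 : q ≤ 1)
    (n : ℕ) (L : List (Sym2 (Fin N))) (hL : L.length + n = 2 * k) (b c : Fin N) :
    |∑ G : SimpleGraph (Fin N), graphWeight (fun _ => q) G *
        ((L.map (edgeDev q G)).prod * (centered q G ^ n) b c)| ≤
      (q / z) ^ k * z ^ L.toFinset.card * (z * N + 2 * k) ^ n := by
  have hq : 0 < q := hz.trans_le hzq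
  induction n generalizing L b with
  | zero =>
    rw [add_zero] at hL
    simp only [pow_zero, mul_one, Matrix.one_apply]
    split_ifs
    · simpa using abs_expect_prod_edgeDev_le' hz hzq h1 L hL
    · simp only [mul_zero, Finset.sum_const_zero, abs_zero]
      positivity
  | succ n ih =>
    have hstep : ∑ G : SimpleGraph (Fin N), graphWeight (fun _ => q) G *
        ((L.map (edgeDev q G)).prod * (centered q G ^ (n + 1)) b c) =
        ∑ a : Fin N, ∑ G : SimpleGraph (Fin N), graphWeight (fun _ => q) G *
          (((s(b, a) :: L).map (edgeDev q G)).prod * (centered q G ^ n) a c) := by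
      rw [Finset.sum_comm]
      refine Finset.sum_congr rfl fun G _ => ?_
      rw [pow_succ', Matrix.mul_apply, Finset.mul_sum, Finset.mul_sum]
      refine Finset.sum_congr rfl fun a _ => ?_
      rw [List.map_cons, List.prod_cons, centered, Matrix.of_apply]
      ring
    rw [hstep]
    have hcard : (L.toFinset.card : ℝ) ≤ 2 * k := by
      have := List.toFinset_card_le L
      exact_mod_cast (show L.toFinset.card ≤ 2 * k by omega)
    calc _ ≤ ∑ a : Fin N, (q / z) ^ k * z ^ (s(b, a) :: L).toFinset.card * (z * N + 2 * k) ^ n := by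
          refine (Finset.abs_sum_le_sum_abs _ _).trans (Finset.sum_le_sum fun a _ => ?_)
          exact ih _ (by rw [List.length_cons]; omega) a
      _ = (q / z) ^ k * (∑ a : Fin N, z ^ (insert s(b, a) L.toFinset).card) *
            (z * N + 2 * k) ^ n := by
          rw [Finset.mul_sum, Finset.sum_mul]
          simp only [List.toFinset_cons]
      _ ≤ (q / z) ^ k * (z ^ L.toFinset.card * (z * N + 2 * k)) * (z * N + 2 * k) ^ n := by
          gcongr
          refine (sum_pow_card_insert_le hz.le L.toFinset b).trans ?_
          gcongr
      _ = _ := by ring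

/-- The trace moment bound. -/
theorem expect_trace_pow_le {N k : ℕ} (hk : 1 ≤ k) {q : ℝ} (hkq : 2 * (k : ℝ) ≤ N * q)
    (h1 : q ≤ 1) :
    ∑ G : SimpleGraph (Fin N), graphWeight (fun _ => q) G * (centered q G ^ (2 * k)).trace ≤
      N * (8 * k * (N * q)) ^ k := by
  have hk' : (1 : ℝ) ≤ k := by exact_mod_cast hk
  have hN : (0 : ℝ) < N := by
    rcases Nat.eq_zero_or_pos N with rfl | h
    · norm_num at hkq
      linarith
    · exact_mod_cast h
  -- With `z = 2 * k / N`, new and old edges have equal bounds, so a step costs `4 * k` and `(q / z)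
  -- ^ k * (4 * k) ^ (2 * k) = (8 * k * (N * q)) ^ k`.
  have hz : 0 < 2 * (k : ℝ) / N := by positivity
  have hzq : 2 * (k : ℝ) / N ≤ q := by rwa [div_le_iff₀ hN, mul_comm q]
  have hq : 0 < q := hz.trans_le hzq
  have hb : ∀ b : Fin N, ∑ G : SimpleGraph (Fin N), graphWeight (fun _ => q) G *
      (centered q G ^ (2 * k)) b b ≤ (8 * k * (N * q)) ^ k := by
    intro b
    have h := (le_abs_self _).trans
      (abs_expect_prod_mul_pow_le (k := k) hz hzq h1 (2 * k) [] (by simp) b b)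
    simp only [List.map_nil, List.prod_nil, one_mul, List.toFinset_nil, Finset.card_empty,
      pow_zero, mul_one] at h
    refine h.trans (le_of_eq ?_)
    rw [pow_mul, ← mul_pow]
    congr 1
    field_simp
    ring
  calc _ = ∑ b : Fin N, ∑ G : SimpleGraph (Fin N), graphWeight (fun _ => q) G *
      (centered q G ^ (2 * k)) b b := by
        rw [Finset.sum_comm]
        refine Finset.sum_congr rfl fun G _ => ?_
        rw [Matrix.trace, Finset.mul_sum]
        rfl
    _ ≤ ∑ b : Fin N, (8 * k * (N * q)) ^ k := Finset.sum_le_sum fun b _ => hb b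
    _ = N * (8 * k * (N * q)) ^ k := by simp

/-! ### Concentration of the adjacency matrix -/

open Matrix in
theorem dotProduct_adj_mulVec {N : ℕ} (q : ℝ) (G : SimpleGraph (Fin N)) (v : Fin N → ℝ) :
    v ⬝ᵥ ((adj G : Matrix (Fin N) (Fin N) ℝ) *ᵥ v) =
      v ⬝ᵥ (centered q G *ᵥ v) + q * ((∑ i, v i) ^ 2 - v ⬝ᵥ v) := by
  classical
  have h : (adj G : Matrix (Fin N) (Fin N) ℝ) =
      centered q G + q • (Matrix.of (fun _ _ => 1) - 1) := by
    ext i j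
    simp only [adj, centered, edgeDev, SimpleGraph.adjMatrix_apply, Matrix.add_apply,
      Matrix.smul_apply, Matrix.sub_apply, Matrix.of_apply, Matrix.one_apply, smul_eq_mul,
      Sym2.mk_isDiag_iff, SimpleGraph.mem_edgeSet]
    by_cases hij : i = j
    · subst hij
      simp
    · by_cases hG : G.Adj i j <;> simp [hij, hG]
  have hJ : (Matrix.of (fun _ _ => 1) : Matrix (Fin N) (Fin N) ℝ) *ᵥ v = fun _ => ∑ i, v i := by
    ext i
    simp [Matrix.mulVec, dotProduct]
  rw [h, Matrix.add_mulVec, dotProduct_add, Matrix.smul_mulVec, dotProduct_smul,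
    Matrix.sub_mulVec, dotProduct_sub, Matrix.one_mulVec, hJ]
  congr 2
  rw [dotProduct, ← Finset.sum_mul, sq]

/-- In the eigenbasis of `adj G` its eigenvalues split along `q (J - I) + centered`. The diagonal of
`J` is nonnegative with sum `N`, so its `ℓ^α` norm is at most `N`; that of `I` has norm `N ^ (1 /
α)`. -/
theorem schattenNorm_adj_le {α : ℝ≥0∞} [Fact (1 ≤ α)] {N : ℕ} (hN : 1 ≤ N) {q : ℝ} (hq : 0 ≤ q)
    (G : SimpleGraph (Fin N)) :
    schattenNorm α (adj G) ≤ q * (N + (N : ℝ) ^ (1 / α).toReal) +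
      ‖WithLp.toLp α (centered_isHermitian q G).eigenvalues‖ := by
  have : Nonempty (Fin N) := ⟨⟨0, hN⟩⟩
  set v := (cX_isHermitian (adj G)).eigenvectorBasis with hv
  let one : EuclideanSpace ℝ (Fin N) := WithLp.toLp 2 fun _ => 1
  have hsum : ∀ j, ∑ i, (v j).ofLp i = inner ℝ (v j) one := by
    intro j
    rw [inner_eq_dotProduct]
    simp [one, dotProduct]
  have hself : ∀ j, (v j).ofLp ⬝ᵥ (v j).ofLp = 1 := by
    intro j
    rw [← inner_eq_dotProduct, real_inner_self_eq_norm_sq, v.norm_eq_one, one_pow]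
  have hdecomp : WithLp.toLp α (cX_isHermitian (adj G)).eigenvalues =
      q • (WithLp.toLp α (fun j => inner ℝ (v j) one ^ 2) -
        WithLp.toLp α (Function.const (Fin N) (1 : ℝ))) +
      WithLp.toLp α (fun j => (v j).ofLp ⬝ᵥ ((centered q G).mulVec (v j).ofLp)) := by
    ext j
    simp only [PiLp.add_apply, PiLp.smul_apply, PiLp.sub_apply, Function.const_apply, smul_eq_mul]
    rw [eigenvalues_eq_dotProduct, ← hv, dotProduct_adj_mulVec q, hsum, hself]
    ring
  have hone : ‖one‖ ^ 2 = N := by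
    rw [EuclideanSpace.norm_sq_eq]
    simp [one]
  have h1 : ‖WithLp.toLp α (fun j => inner ℝ (v j) one ^ 2)‖ ≤ N := by
    refine (norm_toLp_le_sum α _).trans (le_of_eq ?_)
    simp only [abs_sq]
    rw [v.sum_sq_inner_right, hone]
  have h2 : ‖WithLp.toLp α (Function.const (Fin N) (1 : ℝ))‖ = (N : ℝ) ^ (1 / α).toReal := by
    rw [PiLp.norm_toLp_const']
    simp
  rw [schattenNorm, hdecomp]
  refine (norm_add_le _ _).trans (add_le_add ?_ (norm_diag_le α _ v))
  rw [norm_smul, Real.norm_of_nonneg hq]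
  refine mul_le_mul_of_nonneg_left ((norm_sub_le _ _).trans ?_) hq
  rw [h2]
  linarith

theorem trace_centered_pow_nonneg {N : ℕ} (q : ℝ) (G : SimpleGraph (Fin N)) (k : ℕ) :
    0 ≤ (centered q G ^ (2 * k)).trace := by
  rw [trace_pow_eq_sum_eigenvalues (centered_isHermitian q G)]
  exact Finset.sum_nonneg fun i _ => by rw [pow_mul]; positivity

/-- Markov's inequality for the trace, which is nonnegative because the power is even. -/
theorem sum_graphWeight_ge {N k : ℕ} (hk : 1 ≤ k) {q : ℝ} (hq0 : 0 ≤ q)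
    (hkq : 2 * (k : ℝ) ≤ N * q) (h1 : q ≤ 1) {T : ℝ} (hT : 0 < T)
    {K : Finset (SimpleGraph (Fin N))} (hK : ∀ G, (centered q G ^ (2 * k)).trace ≤ T → G ∈ K) :
    1 - N * (8 * k * (N * q)) ^ k / T ≤ ∑ G ∈ K, graphWeight (fun _ => q) G := by
  classical
  have hw : ∀ G : SimpleGraph (Fin N), 0 ≤ graphWeight (fun _ => q) G :=
    graphWeight_nonneg (fun _ => hq0) (fun _ => h1)
  have hc : ∑ G ∈ Kᶜ, graphWeight (fun _ => q) G ≤ N * (8 * k * (N * q)) ^ k / T := by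
    rw [le_div_iff₀ hT, Finset.sum_mul]
    refine le_trans ?_ (expect_trace_pow_le hk hkq h1)
    calc ∑ G ∈ Kᶜ, graphWeight (fun _ => q) G * T
        ≤ ∑ G ∈ Kᶜ, graphWeight (fun _ => q) G * (centered q G ^ (2 * k)).trace := by
          refine Finset.sum_le_sum fun G hG => mul_le_mul_of_nonneg_left ?_ (hw G)
          by_contra hlt
          exact Finset.mem_compl.1 hG (hK G (not_le.1 hlt).le)
      _ ≤ _ := Finset.sum_le_sum_of_subset_of_nonneg (Finset.subset_univ _)
          fun G _ _ => mul_nonneg (hw G) (trace_centered_pow_nonneg q G k)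
  have := Finset.sum_add_sum_compl K (graphWeight (fun _ => q))
  rw [sum_graphWeight] at this
  linarith

/-- Concentration of the centered adjacency matrix in a finite Schatten norm. -/
theorem concentration_of_ne_top {α : ℝ≥0∞} (hα1 : 1 ≤ α) (hα : α ≠ ∞) {k : ℕ} (hk : 1 ≤ k)
    (hαk : α.toReal ≤ 2 * k) {N : ℕ} (hN : 1 ≤ N) {q η : ℝ} (hkq : 2 * (k : ℝ) ≤ N * q)
    (h1 : q ≤ 1) (hη : 0 < η)
    {K : Finset (SimpleGraph (Fin N))} (hK : ∀ G,
      ‖WithLp.toLp α (centered_isHermitian q G).eigenvalues‖ ≤ η * (N * q) → G ∈ K) :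
    1 - (8 * k / η ^ 2 * ((N : ℝ) ^ (2 / α.toReal - 1) / q)) ^ k ≤
      ∑ G ∈ K, graphWeight (fun _ => q) G := by
  have hk' : (1 : ℝ) ≤ k := by exact_mod_cast hk
  have hN' : (0 : ℝ) < N := by exact_mod_cast hN
  have hq : 0 < q := by
    by_contra h
    nlinarith
  have : Nonempty (Fin N) := ⟨⟨0, hN⟩⟩
  set x := (N : ℝ) ^ (1 / α.toReal) with hx
  have hx0 : 0 < x := Real.rpow_pos_of_pos hN' _
  have hx2 : (N : ℝ) ^ (2 / α.toReal - 1) = x ^ 2 / N := by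
    rw [Real.rpow_sub hN', Real.rpow_one, hx, ← Real.rpow_natCast, ← Real.rpow_mul hN'.le]
    congr 2
    push_cast
    ring
  -- A spectrum with all `N` entries of size `b` has Schatten norm exactly `η * (N * q)`.
  set b := η * (N * q) / x with hb
  have hb0 : 0 < b := by positivity
  have h := sum_graphWeight_ge (T := N * b ^ (2 * k)) hk hq.le hkq h1 (by positivity)
    (K := K) ?_
  · convert h using 2
    rw [mul_div_mul_left _ _ hN'.ne', pow_mul, ← div_pow, hx2, hb]
    congr 1
    field_simp
  · intro G hG
    refine hK G ?_
    rw [trace_pow_eq_sum_eigenvalues (centered_isHermitian q G)] at hG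
    have := norm_toLp_le_of_sum_pow_le hα1 hα hαk hb0.le
      (x := (centered_isHermitian q G).eigenvalues) (by simpa using hG)
    refine this.trans (le_of_eq ?_)
    rw [Fintype.card_fin, ← hx, hb]
    field_simp

/-- Concentration of the centered adjacency matrix in the operator norm. -/
theorem concentration_top {k : ℕ} (hk : 1 ≤ k) {N : ℕ} (hN : 1 ≤ N) {q η : ℝ}
    (hkq : 2 * (k : ℝ) ≤ N * q) (h1 : q ≤ 1) (hη : 0 < η)
    {K : Finset (SimpleGraph (Fin N))} (hK : ∀ G,
      ‖WithLp.toLp ∞ (centered_isHermitian q G).eigenvalues‖ ≤ η * (N * q) → G ∈ K) :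
    1 - N * (8 * k / η ^ 2 / (N * q)) ^ k ≤ ∑ G ∈ K, graphWeight (fun _ => q) G := by
  have hk' : (1 : ℝ) ≤ k := by exact_mod_cast hk
  have hN' : (0 : ℝ) < N := by exact_mod_cast hN
  have hq : 0 < q := by
    by_contra h
    nlinarith
  set b := η * (N * q) with hb
  have hb0 : 0 < b := by positivity
  have h := sum_graphWeight_ge (T := b ^ (2 * k)) hk hq.le hkq h1 (by positivity) (K := K) ?_
  · convert h using 2
    rw [pow_mul, mul_div_assoc (N : ℝ) (_ ^ k), ← div_pow, hb]
    congr 2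
    field_simp
  · intro G hG
    refine hK G ?_
    rw [trace_pow_eq_sum_eigenvalues (centered_isHermitian q G)] at hG
    exact norm_toLp_top_le_of_sum_pow_le (by omega) hb0.le hG

/-- A fixed `k ≥ α` suffices: the hypothesis on `p` eventually brings the base of the `k`-th power
below `κ`. -/
theorem eventually_concentration_of_ne_top {α : ℝ≥0∞} (hα2 : 2 < α) (hα : α ≠ ∞)
    {p : ℕ → unitInterval} {r η κ : ℝ} (hr0 : 0 < r) (hr1 : r < 1) (hη : 0 < η) (hκ : 0 < κ)
    (hκ1 : κ ≤ 1)
    (hp : (fun N : ℕ => (N : ℝ) ^ (2 / α.toReal - 1)) =o[atTop] fun N => (p N : ℝ)) :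
    ∀ᶠ N : ℕ in atTop, 1 ≤ (N : ℝ) * p N ∧ ∀ K : Finset (SimpleGraph (Fin N)),
      (∀ G, ‖WithLp.toLp α (centered_isHermitian (r * p N) G).eigenvalues‖ ≤
        η * (N * (r * p N)) → G ∈ K) →
      1 - κ ≤ ∑ G ∈ K, graphWeight (fun _ => r * (p N : ℝ)) G := by
  obtain ⟨k, hk⟩ := exists_nat_ge (max 1 α.toReal)
  have hk1 : (1 : ℝ) ≤ k := (le_max_left _ _).trans hk
  have hkα : α.toReal ≤ k := (le_max_right _ _).trans hk
  have hα1 : 1 ≤ α := le_trans (by norm_num) hα2.le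
  have hc1 : 0 < κ * r * η ^ 2 / (8 * k) := by positivity
  have hc2 : 0 < r / (2 * k) := by positivity
  filter_upwards [hp.bound hc1, hp.bound hc2, eventually_ge_atTop 1] with N h1 h2 hN
  have hN' : (1 : ℝ) ≤ N := by exact_mod_cast hN
  have hN0 : (0 : ℝ) < N := by linarith
  have hpow : 0 < (N : ℝ) ^ (2 / α.toReal - 1) := Real.rpow_pos_of_pos hN0 _
  rw [Real.norm_of_nonneg hpow.le, Real.norm_of_nonneg (p N).2.1] at h1 h2
  have hp0 : 0 < (p N : ℝ) := by
    by_contra h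
    nlinarith
  -- The product is `N ^ (2 / α)`, so the hypothesis on `p` also forces `N * p` to be large.
  have hNpow : 1 ≤ N * (N : ℝ) ^ (2 / α.toReal - 1) := by
    rw [Real.rpow_sub hN0, Real.rpow_one, mul_div_cancel₀ _ hN0.ne']
    exact Real.one_le_rpow hN' (by positivity)
  have hkq : 2 * (k : ℝ) ≤ N * (r * p N) := by
    have h3 := hNpow.trans (mul_le_mul_of_nonneg_left h2 hN0.le)
    have h4 := mul_le_mul_of_nonneg_left h3 (show 0 ≤ 2 * (k : ℝ) by positivity)
    rw [mul_one] at h4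
    refine h4.trans (le_of_eq ?_)
    field_simp
  have hq1 : r * (p N : ℝ) ≤ 1 := by nlinarith [(p N).2.2]
  refine ⟨?_, fun K hK => ?_⟩
  · have : N * (r * (p N : ℝ)) ≤ N * p N := by
      refine mul_le_mul_of_nonneg_left ?_ hN0.le
      nlinarith
    linarith
  · refine le_trans ?_ (concentration_of_ne_top hα1 hα (by exact_mod_cast hk1) (by linarith) hN hkq
      hq1 hη hK)
    have hb : 8 * k / η ^ 2 * ((N : ℝ) ^ (2 / α.toReal - 1) / (r * p N)) ≤ κ := by
      calc _ ≤ 8 * k / η ^ 2 * ((κ * r * η ^ 2 / (8 * k) * p N) / (r * p N)) := by gcongr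
        _ = κ := by field_simp
    have hpos : 0 ≤ 8 * k / η ^ 2 * ((N : ℝ) ^ (2 / α.toReal - 1) / (r * p N)) := by positivity
    have := pow_le_of_le_one hpos (hb.trans hκ1)
      (n := k) (by rintro rfl; norm_num at hk1)
    linarith

/-- The operator norm bound carries a factor `N`. With `k = ⌈log N⌉` and the base at most `exp
(-2)`, the `k`-th power is at most `N⁻²`, which beats it. -/
theorem eventually_concentration_top
    {p : ℕ → unitInterval} {r η κ : ℝ} (hr0 : 0 < r) (hr1 : r < 1) (hη : 0 < η) (hκ : 0 < κ)
    (hp : (fun N : ℕ => Real.log N ^ 6 / (N : ℝ)) =o[atTop] fun N => (p N : ℝ)) :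
    ∀ᶠ N : ℕ in atTop, 1 ≤ (N : ℝ) * p N ∧ ∀ K : Finset (SimpleGraph (Fin N)),
      (∀ G, ‖WithLp.toLp ∞ (centered_isHermitian (r * p N) G).eigenvalues‖ ≤
        η * (N * (r * p N)) → G ∈ K) →
      1 - κ ≤ ∑ G ∈ K, graphWeight (fun _ => r * (p N : ℝ)) G := by
  -- Since `k ≤ 2 * log N`, the first constant yields `2 * k ≤ N * (r * p N)` and the second brings
  -- the base below `exp (-2)`.
  have hc1 : 0 < r / 4 := by positivity
  have hc2 : 0 < r * η ^ 2 * Real.exp (-2) / 16 := by positivity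
  have hlog : ∀ᶠ N : ℕ in atTop, 1 ≤ Real.log N :=
    (Real.tendsto_log_atTop.comp tendsto_natCast_atTop_atTop).eventually_ge_atTop 1
  have hinv : ∀ᶠ N : ℕ in atTop, κ⁻¹ ≤ (N : ℝ) :=
    tendsto_natCast_atTop_atTop.eventually_ge_atTop _
  filter_upwards [hp.bound hc1, hp.bound hc2, hlog, hinv, eventually_ge_atTop 1] with
    N h1 h2 hl hi hN
  have hN' : (1 : ℝ) ≤ N := by exact_mod_cast hN
  have hN0 : (0 : ℝ) < N := by linarith
  rw [Real.norm_of_nonneg (by positivity), Real.norm_of_nonneg (p N).2.1, div_le_iff₀ hN0]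
    at h1 h2
  have hl6 : Real.log N ≤ Real.log N ^ 6 := le_self_pow₀ hl (by norm_num)
  set k := ⌈Real.log N⌉₊ with hkdef
  have hkl : Real.log N ≤ k := Nat.le_ceil _
  have hk2 : (k : ℝ) ≤ 2 * Real.log N := by
    have := Nat.ceil_lt_add_one (show 0 ≤ Real.log N by linarith)
    linarith
  have hk1 : 1 ≤ k := by
    have : (1 : ℝ) ≤ k := hl.trans hkl
    exact_mod_cast this
  have hkq : 2 * (k : ℝ) ≤ N * (r * p N) := by nlinarith
  have hk1' : (1 : ℝ) ≤ k := by exact_mod_cast hk1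
  have hNrp : 0 < N * (r * (p N : ℝ)) := by linarith
  have hp0 : 0 < (p N : ℝ) := by
    by_contra h
    have : (p N : ℝ) = 0 := le_antisymm (not_lt.1 h) (p N).2.1
    rw [this] at hNrp
    simp at hNrp
  have hq1 : r * (p N : ℝ) ≤ 1 := by nlinarith [(p N).2.2]
  refine ⟨?_, fun K hK => ?_⟩
  · have : N * (r * (p N : ℝ)) ≤ N * p N := by
      refine mul_le_mul_of_nonneg_left ?_ hN0.le
      nlinarith
    linarith
  · refine le_trans ?_ (concentration_top hk1 hN hkq hq1 hη hK)
    have hb : 8 * k / η ^ 2 / (N * (r * p N)) ≤ Real.exp (-2) := by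
      rw [div_le_iff₀ hNrp, div_le_iff₀ (by positivity)]
      nlinarith
    have hb' : (8 * k / η ^ 2 / (N * (r * p N))) ^ k ≤ (N : ℝ)⁻¹ * (N : ℝ)⁻¹ := by
      calc _ ≤ Real.exp (-2) ^ k := by gcongr
        _ = Real.exp (-2 * k) := by rw [← Real.exp_nat_mul, mul_comm]
        _ ≤ Real.exp (-Real.log N + -Real.log N) := by
            rw [Real.exp_le_exp]
            linarith
        _ = (N : ℝ)⁻¹ * (N : ℝ)⁻¹ := by rw [Real.exp_add, Real.exp_neg, Real.exp_log hN0]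
    have hfin : N * (8 * k / η ^ 2 / (N * (r * p N))) ^ k ≤ κ := by
      calc _ ≤ N * ((N : ℝ)⁻¹ * (N : ℝ)⁻¹) := by gcongr
        _ = (N : ℝ)⁻¹ := by field_simp
        _ ≤ κ := inv_le_of_inv_le₀ hκ hi
    linarith

/-! ### The lower bound by tilting -/

theorem rpow_inv_le_sqrt {α : ℝ≥0∞} (hα : 2 < α) {N : ℕ} (hN : 1 ≤ N) :
    (N : ℝ) ^ (1 / α).toReal ≤ √N := by
  rw [Real.sqrt_eq_rpow]
  refine Real.rpow_le_rpow_of_exponent_le (by exact_mod_cast hN) ?_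
  have h : (1 / α).toReal ≤ (1 / 2 : ℝ≥0∞).toReal :=
    ENNReal.toReal_mono (by simp) (ENNReal.div_le_div_left hα.le 1)
  simpa using h

theorem eventually_sqrt_add_one_le {c : ℝ} (hc : 0 < c) :
    ∀ᶠ N : ℕ in atTop, √(N : ℝ) + 1 ≤ c * N := by
  have h : ∀ᶠ N : ℕ in atTop, 1 + 2 / c ≤ √(N : ℝ) :=
    (Real.tendsto_sqrt_atTop.comp tendsto_natCast_atTop_atTop).eventually_ge_atTop _
  filter_upwards [h] with N hN
  have hs := Real.sq_sqrt (Nat.cast_nonneg (α := ℝ) N)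
  have h2 : 0 < 2 / c := by positivity
  have h3 : c * (2 / c) = 2 := by field_simp
  have h4 := mul_le_mul_of_nonneg_left hN hc.le
  have h5 : 2 * √(N : ℝ) ≤ c * √(N : ℝ) * √(N : ℝ) :=
    mul_le_mul_of_nonneg_right (by linarith) (Real.sqrt_nonneg _)
  have h6 : c * √(N : ℝ) * √(N : ℝ) = c * N := by rw [mul_assoc, ← sq, hs]
  linarith

/-- From a change of measure to a measure giving `K` mass close to one. -/
theorem exp_neg_le_of_mul_log_le {P Q D D' κ τ u : ℝ} (hP : 0 < P) (hQ : 1 - κ ≤ Q)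
    (hκ0 : 0 ≤ κ) (hκ : 2 * κ ≤ τ / 4) (hκ1 : κ ≤ 1 / 2) (hu : u ≤ τ / 4)
    (hD : 12 ≤ τ * D) (hD0 : 0 < D) (hD' : D' ≤ (1 + u) * D)
    (h : Q * (Real.log Q - Real.log P) ≤ D' + 1) :
    Real.exp (-((1 + τ) * D)) ≤ P := by
  rw [← Real.le_log_iff_exp_le hP]
  have hQ0 : 0 < Q := by linarith
  have hlogQ : -1 ≤ Real.log Q := by
    have h1 := Real.one_sub_inv_le_log_of_pos hQ0
    have h2 : Q⁻¹ ≤ 2 := inv_le_of_inv_le₀ (by norm_num) (by linarith)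
    linarith
  by_contra hlt
  push Not at hlt
  have hX : 0 < (1 + τ) * D - 1 := by nlinarith
  have h1 : (1 - κ) * ((1 + τ) * D - 1) < Q * (Real.log Q - Real.log P) := by
    calc (1 - κ) * ((1 + τ) * D - 1) ≤ Q * ((1 + τ) * D - 1) := by gcongr
      _ < Q * (Real.log Q - Real.log P) := by
        apply mul_lt_mul_of_pos_left _ hQ0
        linarith
  have h2 : (1 - κ) * ((1 + τ) * D - 1) < (1 + τ / 4) * D + 1 := by
    have : (1 + u) * D ≤ (1 + τ / 4) * D := by gcongr
    linarith
  have h3 : κ * ((1 + τ) * D) ≤ τ / 8 * D + 1 / 2 * (τ * D) := by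
    have e : κ * ((1 + τ) * D) = κ * D + κ * (τ * D) := by ring
    rw [e]
    gcongr
    linarith
  -- In the extreme case `κ = 1 / 2` what remains reads `τ * D / 8 < 3 / 2`, which `12 ≤ τ * D`
  -- excludes.
  nlinarith

theorem eventually_exp_neg_le_lowerTail {α : ℝ≥0∞} {p : ℕ → unitInterval} {s τ : ℝ}
    (hα : 2 < α) (hs0 : 0 < s) (hs1 : s < 1) (hτ : 0 < τ)
    (hhalf : ∀ᶠ N in atTop, (p N : ℝ) ≤ 1 / 2)
    (hfin : α ≠ ∞ → (fun N : ℕ => (N : ℝ) ^ (2 / α.toReal - 1)) =o[atTop] fun N => (p N : ℝ))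
    (htop : α = ∞ → (fun N : ℕ => Real.log N ^ 6 / (N : ℝ)) =o[atTop] fun N => (p N : ℝ)) :
    ∀ᶠ N : ℕ in atTop, 0 < (N.choose 2 : ℝ) * bernoulliKL (p N) (s * p N) ∧
      Real.exp (-((1 + τ) * ((N.choose 2 : ℝ) * bernoulliKL (p N) (s * p N)))) ≤
        lowerTail α N (p N) (s * p N * ((N : ℝ) - 1)) := by
  classical
  have hα1 : 1 ≤ α := le_trans (by norm_num) hα.le
  have : Fact (1 ≤ α) := ⟨hα1⟩
  set c := InformationTheory.klFun s with hc
  have hc0 : 0 < c := lt_of_le_of_ne (InformationTheory.klFun_nonneg hs0.le)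
    (fun h => hs1.ne ((InformationTheory.klFun_eq_zero_iff hs0.le).1 h.symm))
  -- The tilt to `(1 - δ) * s * p` adds at most `2 * δ * p` per pair, against a cost of at least `c
  -- * p`; this choice keeps the ratio below `τ / 4`.
  set δ := min (1 / 2) (c * τ / 8) with hδ
  have hδ0 : 0 < δ := lt_min (by norm_num) (by positivity)
  have hδ1 : δ ≤ 1 / 2 := min_le_left _ _
  have hδτ : 2 * δ / c ≤ τ / 4 := by
    rw [div_le_iff₀ hc0]
    have := min_le_right (1 / 2) (c * τ / 8)
    linarith
  set κ := min (1 / 2) (τ / 8) with hκ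
  have hκ0 : 0 < κ := lt_min (by norm_num) (by positivity)
  have hκ1 : κ ≤ 1 / 2 := min_le_left _ _
  have hκτ : κ ≤ τ / 8 := min_le_right _ _
  set r := (1 - δ) * s with hr
  have hr0 : 0 < r := mul_pos (by linarith) hs0
  have hr1 : r < 1 := by nlinarith
  have hconc : ∀ᶠ N : ℕ in atTop, 1 ≤ (N : ℝ) * p N ∧ ∀ K : Finset (SimpleGraph (Fin N)),
      (∀ G, ‖WithLp.toLp α (centered_isHermitian (r * p N) G).eigenvalues‖ ≤
        δ * (N * (r * p N)) → G ∈ K) →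
      1 - κ ≤ ∑ G ∈ K, graphWeight (fun _ => r * (p N : ℝ)) G := by
    by_cases h : α = ∞
    · have h2 := eventually_concentration_top hr0 hr1 hδ0 hκ0 (htop h)
      subst h
      exact h2
    · exact eventually_concentration_of_ne_top hα h hr0 hr1 hδ0 hκ0 (by linarith) (hfin h)
  have hlarge : ∀ᶠ N : ℕ in atTop, 24 / (c * τ) + 2 ≤ (N : ℝ) :=
    tendsto_natCast_atTop_atTop.eventually_ge_atTop _
  filter_upwards [hconc, hhalf, hlarge, eventually_ge_atTop 2,
    eventually_sqrt_add_one_le (show 0 < δ ^ 2 by positivity)] with N hN hp2 hbig hN2 hsqrt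
  obtain ⟨hNp, hK⟩ := hN
  have hN2' : (2 : ℝ) ≤ N := by exact_mod_cast hN2
  have hp0 : 0 < (p N : ℝ) := by
    by_contra h
    nlinarith
  have hp1 : (p N : ℝ) < 1 := by linarith
  set q := r * (p N : ℝ) with hq
  have hq0 : 0 < q := mul_pos hr0 hp0
  have hq1 : q < 1 := by nlinarith
  set D := (N.choose 2 : ℝ) * bernoulliKL (p N) (s * p N) with hD
  have hI : p N * c ≤ bernoulliKL (p N) (s * p N) := bernoulliKL_lower hp0 hp1 hs1
  -- As `N * p ≥ 1`, the total cost grows at least linearly in `N`, which absorbs the additive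
  -- constants.
  have hDlow : (N - 1) / 2 * c ≤ D := by
    rw [hD, Nat.cast_choose_two]
    calc ((N : ℝ) - 1) / 2 * c ≤ (N - 1) / 2 * c * (N * p N) :=
          le_mul_of_one_le_right (mul_nonneg (by linarith) hc0.le) hNp
      _ = (N : ℝ) * (N - 1) / 2 * (p N * c) := by ring
      _ ≤ _ := mul_le_mul_of_nonneg_left hI (by nlinarith)
  have hD0 : 0 < D := lt_of_lt_of_le (mul_pos (by linarith) hc0) hDlow
  have hDτ : 12 ≤ τ * D := by
    have h1 : 24 ≤ (N - 1) * (c * τ) := by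
      rw [← div_le_iff₀ (by positivity)]
      linarith
    nlinarith [mul_le_mul_of_nonneg_left hDlow hτ.le]
  refine ⟨hD0, ?_⟩
  rw [lowerTail, binomialRandom_real]
  set K : Finset (SimpleGraph (Fin N)) := Finset.univ.filter
    (fun G => G ∈ {G | schattenNorm α (adj G) ≤ s * p N * ((N : ℝ) - 1)}) with hKdef
  have hQ := hK K (fun G hG => by
    rw [hKdef, Finset.mem_filter]
    refine ⟨Finset.mem_univ _, (schattenNorm_adj_le (by omega) hq0.le G).trans ?_⟩
    have h1 := rpow_inv_le_sqrt hα (N := N) (by omega)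
    -- Since `(1 - δ) * (1 + δ) = 1 - δ ^ 2`, a gap `δ ^ 2 * N` is left to absorb `√N + 1`.
    have h2 : (1 - δ) * ((1 + δ) * N + √N) ≤ N - 1 := by
      nlinarith [mul_nonneg hδ0.le (Real.sqrt_nonneg N)]
    calc q * (N + (N : ℝ) ^ (1 / α).toReal) +
          ‖WithLp.toLp α (centered_isHermitian q G).eigenvalues‖
        ≤ q * (N + √N) + δ * (N * q) := by gcongr
      _ = s * p N * ((1 - δ) * ((1 + δ) * N + √N)) := by rw [hq, hr]; ring
      _ ≤ s * p N * (N - 1) := mul_le_mul_of_nonneg_left h2 (by positivity))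
  have hKne : K.Nonempty := by
    rw [Finset.nonempty_iff_ne_empty]
    intro h
    rw [h, Finset.sum_empty] at hQ
    linarith
  have hP : 0 < ∑ G ∈ K, graphWeight (fun _ => (p N : ℝ)) G :=
    Finset.sum_pos (fun G _ => constWeight_pos hp0 hp1 G) hKne
  refine exp_neg_le_of_mul_log_le hP hQ hκ0.le (by linarith) hκ1 hδτ hDτ hD0 ?_
    (mul_log_sum_graphWeight_le hp0 hp1 hq0 hq1 hKne)
  have h1 := bernoulliKL_smul_le hp0 hp2 hs0 hs1 hδ0.le (by linarith)
  have h2 : δ * (2 * p N) ≤ 2 * δ / c * bernoulliKL (p N) (s * p N) := by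
    calc δ * (2 * p N) = 2 * δ / c * (p N * c) := by field_simp
      _ ≤ _ := by gcongr
  calc (N.choose 2 : ℝ) * bernoulliKL (p N) q
      ≤ (N.choose 2 : ℝ) * ((1 + 2 * δ / c) * bernoulliKL (p N) (s * p N)) := by
        refine mul_le_mul_of_nonneg_left ?_ (Nat.cast_nonneg _)
        linarith
    _ = (1 + 2 * δ / c) * D := by rw [hD]; ring

end SchattenTail

end

/-! ### The theorem -/

theorem theorem1p8 :
    (∀ (α : ℝ≥0∞) (N : ℕ) (p : unitInterval) (q : ℝ),
      1 ≤ α → 1 ≤ N → 0 < q → q < (p : ℝ) → (p : ℝ) < 1 →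
        SchattenTail.lowerTail α N p (q * ((N : ℝ) - 1)) ≤
            Real.exp (-SchattenTail.psi (N := N) (SchattenTail.schattenNorm α) p
              (q * ((N : ℝ) - 1))) ∧
          Real.exp (-SchattenTail.psi (N := N) (SchattenTail.schattenNorm α) p
              (q * ((N : ℝ) - 1))) ≤
            Real.exp (-((N.choose 2 : ℝ) * SchattenTail.bernoulliKL p q))) ∧
    (∀ (α : ℝ≥0∞) (p : ℕ → unitInterval) (s : ℝ),
      2 < α → 0 < s → s < 1 →
      (∀ᶠ N in atTop, (p N : ℝ) ≤ 1 / 2) →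
      (α ≠ ∞ → (fun N : ℕ => (N : ℝ) ^ (2 / α.toReal - 1)) =o[atTop] fun N => (p N : ℝ)) →
      (α = ∞ → (fun N : ℕ => Real.log N ^ 6 / (N : ℝ)) =o[atTop] fun N => (p N : ℝ)) →
        ∃ ε : ℕ → ℝ, Tendsto ε atTop (𝓝 0) ∧
          ∀ᶠ N in atTop,
            Real.exp (-((1 + ε N) * (N.choose 2 : ℝ) *
                SchattenTail.bernoulliKL (p N) (s * p N))) ≤
              SchattenTail.lowerTail α N (p N) (s * p N * ((N : ℝ) - 1))) := by
  refine ⟨fun α N p q hα hN hq0 hqp hp1 =>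
    ⟨SchattenTail.lowerTail_le_exp_neg_psi hα (hq0.trans hqp) hp1 _,
      SchattenTail.exp_neg_psi_le hα hN hq0 hqp hp1⟩, ?_⟩
  intro α p s hα hs0 hs1 hhalf hfin htop
  have key := fun τ (hτ : 0 < τ) =>
    SchattenTail.eventually_exp_neg_le_lowerTail hα hs0 hs1 hτ hhalf hfin htop
  let D : ℕ → ℝ := fun N => (N.choose 2 : ℝ) * SchattenTail.bernoulliKL (p N) (s * p N)
  let P : ℕ → ℝ := fun N => SchattenTail.lowerTail α N (p N) (s * p N * ((N : ℝ) - 1))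
  -- The least nonnegative `ε N` for which the bound holds; the estimate for each fixed `τ` shows
  -- that it tends to zero.
  refine ⟨fun N => max 0 (-Real.log (P N) / D N - 1), ?_, ?_⟩
  · rw [Metric.tendsto_nhds]
    intro τ hτ
    filter_upwards [key (τ / 2) (by positivity)] with N ⟨hD, hP⟩
    have hP0 : 0 < P N := (Real.exp_pos _).trans_le hP
    have h : -((1 + τ / 2) * D N) ≤ Real.log (P N) := (Real.le_log_iff_exp_le hP0).2 hP
    have h2 : -Real.log (P N) / D N ≤ 1 + τ / 2 := by
      rw [div_le_iff₀ hD]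
      linarith
    rw [Real.dist_eq, sub_zero, abs_of_nonneg (le_max_left _ _)]
    exact max_lt hτ (by linarith)
  · filter_upwards [key 1 one_pos] with N ⟨hD, hP⟩
    have hP0 : 0 < P N := (Real.exp_pos _).trans_le hP
    change _ ≤ P N
    rw [← Real.le_log_iff_exp_le hP0, mul_assoc]
    have h := le_max_right 0 (-Real.log (P N) / D N - 1)
    have h2 : -Real.log (P N) / D N ≤ 1 + max 0 (-Real.log (P N) / D N - 1) := by linarith
    rw [div_le_iff₀ hD] at h2
    change -((1 + max 0 (-Real.log (P N) / D N - 1)) * D N) ≤ _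
    linarith
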